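/- **Setting.** All vector spaces are real. Let $X$ be a Banach space with topological dual $X^*$, $\Omega\subset X$ an open set, $Y$ a vector space and $H\subset Y$ an infinite-dimensional linear subspace. For each $x\in\Omega$ let $Q(x,\cdot)$ be a positive definite quadratic form on $Y$ for which $H$ is $Q(x,\cdot)^{1/2}$-dense in $Y$, and let $G(x,\cdot)$ be a quadratic form on $H$; denote by $B(x,\cdot,\cdot)$ and $\Gamma(x,\cdot,\cdot)$ the associated symmetric bilinear forms ($B(x,u,u)=Q(x,u)$, $\Gamma(x,v,v)=G(x,v)$). A subscript $x$ denotes the Fréchet derivative in the variable $x$. Assume that for every $x\in\Omega$ there are a neighbourhood $V\subset\Omega$ of $x$ and a bounded function $\theta:V\to(0,+\infty)$ such that, with $N(x',v):=[G(x',v)+\theta(x')Q(x',v)]^{1/2}$: 1. for every $x'\in V$, $N(x',\cdot)$ is a Hilbert norm on $H$ (it comes from a scalar product and $H$ is complete for it); 2. there is $C\ge 1$ with $C^{-1}N(x',\cdot)\le N(x,\cdot)\le C\,N(x',\cdot)$ on $H$ for all $x'\in V$; 3. if $x_n\in V$, $x_n\to x$, $u_n\in H$ and $\sup_n N(x_n,u_n)<\infty$,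 then there is $u\in H$ such that, along a common subsequence, $Q(x_n,u_n-u)\to0$ and $\Gamma(x_n,u_n,h)\to\Gamma(x,u,h)$ for all $h\in H$; 4. $Q(\cdot,u)$ and $G(\cdot,v)$ are Fréchet differentiable at $x$ for all $u\in Y$, $v\in H$; 5. if $x_n\in V$, $x_n\to x$, $u_n,u\in Y$ and $Q(x_n,u_n-u)\to0$, then $Q(x_n,u_n)\to Q(x,u)$ and $Q_x(x_n,u_n)\to Q_x(x,u)$ in $X^*$; if $x_n\in V$, $x_n\to x$, $v_n,v\in H$ and $N(x_n,v_n-v)\to0$, then $G(x_n,v_n)\to G(x,v)$ and $G_x(x_n,v_n)\to G_x(x,v)$ in $X^*$ (norm convergence in $X^*$); 6. there is $C_0>0$ with $\|B_x(x',v_1,v_2)\|_{X^*}\le C_0N(x',v_1)N(x',v_2)$ and $\|\Gamma_x(x',v_1,v_2)\|_{X^*}\le C_0N(x',v_1)N(x',v_2)$ for all $x'\in V$, $v_1,v_2\in H$. Let $\mathcal R(x,v)=G(x,v)/Q(x,v)$ for $v\in H\setminus\{0\}$, and let $\mathcal R_x(x,v)\in X^*$ be the Fréchet derivative of $\mathcal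 R(\cdot,v)$ at $x$. For an integer $k\ge1$ let $$\lambda_k(x)=\inf_{E\subset H,\ \dim E=k}\ \sup_{u\in E,\ Q(x,u)=1}\mathcal R(x,u),$$ let $L(x)$ be the operator defined by $L(x)u=\gamma\in Y$ if $\Gamma(x,u,v)=B(x,\gamma,v)$ for all $v\in H$, and let $$E_k(x)=\{u\in H: L(x)u=\lambda_k(x)u\},\qquad SE_k(x)=\{u\in E_k(x):Q(x,u)=1\}.$$ For $F:\Omega\to\mathbb R$ and $x\in\Omega$, $h\in X$, let $$F_r'(x;h)=\lim_{t\downarrow0}\frac{F(x+th)-F(x)}t,\quad F_+^\circ(x;h)=\limsup_{y\to x,\,t\downarrow0}\frac{F(y+th)-F(y)}t,\quad F_-^\circ(x;h)=\liminf_{y\to x,\,t\downarrow0}\frac{F(y+th)-F(y)}t .$$ The classical subdifferential $\partial^-F(x)$ (resp. superdifferential $\partial^+F(x)$) is the set of $\zeta\in X^*$ such that, for every $h\in X$, the limit $F_r'(x;h)$ exists in $\mathbb R$ and $\langle\zeta,h\rangle\le F_r'(x;h)$ (resp. $\ge$). The Clarke subdifferential and superdifferential are $$\partial_C^-F(x)=\{\zeta\in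 X^*:\langle\zeta,h\rangle\le F_+^\circ(x;h)\ \forall h\in X\},\qquad \partial_C^+F(x)=\{\zeta\in X^*:\langle\zeta,h\rangle\ge F_-^\circ(x;h)\ \forall h\in X\}.$$ **Proposition.** For $x\in\Omega$ and an integer $k\ge1$, let $C_k(x)\subset X^*$ be the convex hull of $\{\mathcal R_x(x,u):u\in SE_k(x)\}$. Then $$\partial_C^-\lambda_k(x)\subset C_k(x)\quad\text{and}\quad\partial_C^+\lambda_k(x)\subset C_k(x).$$ Moreover, if $\lambda_k(x)<\lambda_{k+1}(x)$, then $\partial^-\lambda_k(x)=\partial_C^-\lambda_k(x)=C_k(x)$; and if $k=1$ or $\lambda_k(x)>\lambda_{k-1}(x)$, then $\partial^+\lambda_k(x)=\partial_C^+\lambda_k(x)=C_k(x)$. -/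

import Mathlib

open Filter Topology Set

noncomputable section

/-! ## Nonsmooth analysis

For a real function `F` defined near a point `x` of a real normed space `X`. Values of `F` away
from `x` play no role. -/

namespace Nonsmooth

variable {X : Type*} [NormedAddCommGroup X] [NormedSpace ℝ X]

/-- `d` is the right directional derivative of `F` at `x` in the direction `h`, that is, the limit
of `(F (x + t h) - F x) / t` as `t ↓ 0`. -/
def HasRightDirDeriv (F : X → ℝ) (x h : X) (d : ℝ) : Prop :=
  Tendsto (fun t : ℝ => (F (x + t • h) - F x) / t) (𝓝[>] 0) (𝓝 d)

/-- The classical subdifferential: the `ζ ∈ X*` such that `⟨ζ, h⟩ ≤ F'_r(x; h)` for every `h`,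
the right directional derivative being required to exist in every direction. -/
def subdiff (F : X → ℝ) (x : X) : Set (X →L[ℝ] ℝ) :=
  {ζ | ∀ h : X, ∃ d : ℝ, HasRightDirDeriv F x h d ∧ ζ h ≤ d}

/-- The classical superdifferential: the `ζ ∈ X*` such that `⟨ζ, h⟩ ≥ F'_r(x; h)` for every `h`,
the right directional derivative being required to exist in every direction. -/
def superdiff (F : X → ℝ) (x : X) : Set (X →L[ℝ] ℝ) :=
  {ζ | ∀ h : X, ∃ d : ℝ, HasRightDirDeriv F x h d ∧ d ≤ ζ h}

/-- The difference quotient `(F (y + t h) - F y) / t` at `p = (y, t)`, as an extended real, so that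
its upper and lower limits below are the true ones also when they are infinite. -/
def quotient (F : X → ℝ) (h : X) (p : X × ℝ) : EReal :=
  (((F (p.1 + p.2 • h) - F p.1) / p.2 : ℝ) : EReal)

/-- The generalized upper directional derivative: upper limit of the difference quotient as
`y → x` and `t ↓ 0`. -/
def upperDirDeriv (F : X → ℝ) (x h : X) : EReal :=
  limsup (quotient F h) (𝓝 x ×ˢ 𝓝[>] (0 : ℝ))

/-- The generalized lower directional derivative: lower limit of the difference quotient as
`y → x` and `t ↓ 0`. -/
def lowerDirDeriv (F : X → ℝ) (x h : X) : EReal :=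
  liminf (quotient F h) (𝓝 x ×ˢ 𝓝[>] (0 : ℝ))

/-- The Clarke subdifferential. -/
def clarkeSubdiff (F : X → ℝ) (x : X) : Set (X →L[ℝ] ℝ) :=
  {ζ | ∀ h : X, ((ζ h : ℝ) : EReal) ≤ upperDirDeriv F x h}

/-- The Clarke superdifferential. -/
def clarkeSuperdiff (F : X → ℝ) (x : X) : Set (X →L[ℝ] ℝ) :=
  {ζ | ∀ h : X, lowerDirDeriv F x h ≤ ((ζ h : ℝ) : EReal)}

end Nonsmooth

/-! ## Parametrized Rayleigh quotients -/

/-- The data of a Rayleigh quotient depending on a parameter `x ∈ X`: quadratic forms `Q x` on `Y`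
and quadratic forms `G x` on the subspace `H` of `Y`. Only the parameters in the open set `Ω` of
the assumptions below matter. -/
structure RayleighData (X Y : Type*) [AddCommGroup Y] [Module ℝ Y] where
  /-- the common domain of the quadratic forms `G x` -/
  H : Submodule ℝ Y
  /-- the denominator -/
  Q : X → QuadraticForm ℝ Y
  /-- the numerator -/
  G : X → QuadraticForm ℝ H

namespace RayleighData

variable {X Y : Type*} [NormedAddCommGroup X] [NormedSpace ℝ X] [AddCommGroup Y] [Module ℝ Y]

/-- The symmetric bilinear form with `B x u u = Q x u`. -/
def B (D : RayleighData X Y) (x : X) : LinearMap.BilinForm ℝ Y :=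
  QuadraticMap.associated (D.Q x)

/-- The symmetric bilinear form with `Γ x v v = G x v`. -/
def Γ (D : RayleighData X Y) (x : X) : LinearMap.BilinForm ℝ D.H :=
  QuadraticMap.associated (D.G x)

/-- `N_θ(x, v) = (G(x, v) + θ(x) Q(x, v))^{1/2}`. -/
def N (D : RayleighData X Y) (θ : X → ℝ) (x : X) (v : D.H) : ℝ :=
  Real.sqrt (D.G x v + θ x * D.Q x (v : Y))

/-- The Rayleigh quotient `G / Q` on the subspace `H`, where it is finite. -/
def R (D : RayleighData X Y) (x : X) (v : D.H) : ℝ :=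
  D.G x v / D.Q x (v : Y)

/-- The Fréchet derivative of `y ↦ R(y, v)` at `x`. -/
def Rx (D : RayleighData X Y) (x : X) (v : D.H) : X →L[ℝ] ℝ :=
  fderiv ℝ (fun y => D.R y v) x

/-- The local part of the standing assumptions, at a point `x` of `Ω`, for a neighbourhood `V` of
`x` on which `θ` gives the norms `N`. -/
structure LocalAssumptions (D : RayleighData X Y) (Ω : Set X) (x : X) (V : Set X) (θ : X → ℝ) :
    Prop where
  nhd : V ∈ 𝓝 x
  subset : V ⊆ Ω
  θ_pos : ∀ x' ∈ V, 0 < θ x'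
  θ_bdd : ∃ M : ℝ, ∀ x' ∈ V, θ x' ≤ M
  /-- `N(x', ·)` is the norm of a scalar product on `H` … -/
  N_posDef : ∀ x' ∈ V, ∀ v : D.H, v ≠ 0 → 0 < D.G x' v + θ x' * D.Q x' (v : Y)
  /-- … and `H` is complete for this norm. -/
  N_complete : ∀ x' ∈ V, ∀ v : ℕ → D.H,
    (∀ ε > 0, ∃ n₀ : ℕ, ∀ m ≥ n₀, ∀ n ≥ n₀, D.N θ x' (v m - v n) < ε) →
    ∃ w : D.H, Tendsto (fun n => D.N θ x' (v n - w)) atTop (𝓝 0)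
  /-- The norms `N(x', ·)` are uniformly equivalent to `N(x, ·)`. -/
  N_equiv : ∃ C : ℝ, 1 ≤ C ∧ ∀ x' ∈ V, ∀ v : D.H,
    C⁻¹ * D.N θ x' v ≤ D.N θ x v ∧ D.N θ x v ≤ C * D.N θ x' v
  /-- Compactness: `N`-bounded sequences subconverge for `Q`, and weakly for `Γ`. -/
  compactness : ∀ (xs : ℕ → X) (u : ℕ → D.H), (∀ n, xs n ∈ V) → Tendsto xs atTop (𝓝 x) →
    (∃ M : ℝ, ∀ n, D.N θ (xs n) (u n) ≤ M) →
    ∃ (u₀ : D.H) (φ : ℕ → ℕ), StrictMono φ ∧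
      Tendsto (fun n => D.Q (xs (φ n)) ((u (φ n) : Y) - (u₀ : Y))) atTop (𝓝 0) ∧
      ∀ h : D.H, Tendsto (fun n => D.Γ (xs (φ n)) (u (φ n)) h) atTop (𝓝 (D.Γ x u₀ h))
  differentiable_Q : ∀ u : Y, DifferentiableAt ℝ (fun y => D.Q y u) x
  differentiable_G : ∀ v : D.H, DifferentiableAt ℝ (fun y => D.G y v) x
  /-- Continuity of `Q` and of its derivative in `x`. -/
  continuity_Q : ∀ (xs : ℕ → X) (u : ℕ → Y) (u₀ : Y), (∀ n, xs n ∈ V) →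
    Tendsto xs atTop (𝓝 x) → Tendsto (fun n => D.Q (xs n) (u n - u₀)) atTop (𝓝 0) →
    Tendsto (fun n => D.Q (xs n) (u n)) atTop (𝓝 (D.Q x u₀)) ∧
    Tendsto (fun n => fderiv ℝ (fun y => D.Q y (u n)) (xs n)) atTop
      (𝓝 (fderiv ℝ (fun y => D.Q y u₀) x))
  /-- Continuity of `G` and of its derivative in `x`. -/
  continuity_G : ∀ (xs : ℕ → X) (v : ℕ → D.H) (v₀ : D.H), (∀ n, xs n ∈ V) →
    Tendsto xs atTop (𝓝 x) → Tendsto (fun n => D.N θ (xs n) (v n - v₀)) atTop (𝓝 0) →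
    Tendsto (fun n => D.G (xs n) (v n)) atTop (𝓝 (D.G x v₀)) ∧
    Tendsto (fun n => fderiv ℝ (fun y => D.G y (v n)) (xs n)) atTop
      (𝓝 (fderiv ℝ (fun y => D.G y v₀) x))
  /-- Bounds for the derivatives in `x` of the bilinear forms. -/
  bound : ∃ C₀ : ℝ, 0 < C₀ ∧ ∀ x' ∈ V, ∀ v₁ v₂ : D.H,
    ‖fderiv ℝ (fun y => D.B y (v₁ : Y) (v₂ : Y)) x'‖ ≤ C₀ * D.N θ x' v₁ * D.N θ x' v₂ ∧
    ‖fderiv ℝ (fun y => D.Γ y v₁ v₂) x'‖ ≤ C₀ * D.N θ x' v₁ * D.N θ x' v₂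

/-- The standing assumptions on the Rayleigh quotient over the open set `Ω` of parameters. The
neighbourhood and the function `θ` may depend on the point. -/
structure StandingAssumptions (D : RayleighData X Y) (Ω : Set X) : Prop where
  posDef : ∀ x ∈ Ω, (D.Q x).PosDef
  /-- `H` is dense in `Y` for the norm `Q(x, ·)^{1/2}`. -/
  dense : ∀ x ∈ Ω, ∀ u : Y, ∀ ε > 0, ∃ v : D.H, D.Q x (u - (v : Y)) < ε
  loc : ∀ x ∈ Ω, ∃ (V : Set X) (θ : X → ℝ), D.LocalAssumptions Ω x V θ

/-- The `k`-th eigenvalue (`k ≥ 1`), by the min-max formula: the infimum over the `k`-dimensional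
subspaces `E` of `H` of the supremum of `R(x, ·)` over the `Q(x, ·)`-unit sphere of `E`. -/
def eigenvalue (D : RayleighData X Y) (k : ℕ) (x : X) : ℝ :=
  ⨅ E : {E : Submodule ℝ D.H // Module.finrank ℝ E = k},
    ⨆ u : {u : D.H // u ∈ E.1 ∧ D.Q x (u : Y) = 1}, D.R x u.1

/-- `L(x) u = γ` for the operator `L(x)` on `Y` represented by the form `Γ(x, ·, ·)`: the vector
`γ ∈ Y` satisfies `Γ(x, u, v) = B(x, γ, v)` for every `v ∈ H`. It is unique, `H` being dense. -/
def OperatorMapsTo (D : RayleighData X Y) (x : X) (u : D.H) (γ : Y) : Prop :=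
  ∀ v : D.H, D.Γ x u v = D.B x γ (v : Y)

/-- The eigenspace `E_k(x) = {u ∈ H : L(x) u = λ_k(x) u}`. -/
def eigenspace (D : RayleighData X Y) (k : ℕ) (x : X) : Set D.H :=
  {u | D.OperatorMapsTo x u (D.eigenvalue k x • (u : Y))}

/-- The unit sphere `SE_k(x)` of the eigenspace, for the norm `Q(x, ·)^{1/2}`. -/
def unitEigenvectors (D : RayleighData X Y) (k : ℕ) (x : X) : Set D.H :=
  {u | u ∈ D.eigenspace k x ∧ D.Q x (u : Y) = 1}

/-- The convex hull `C_k(x)` of the derivatives `R_x(x, u)`, `u ∈ SE_k(x)`. -/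
def C (D : RayleighData X Y) (k : ℕ) (x : X) : Set (X →L[ℝ] ℝ) :=
  convexHull ℝ (D.Rx x '' D.unitEigenvectors k x)

end RayleighData

end

/-!
The idea is that difference quotients of an eigenvalue can be compared with difference quotients
of the Rayleigh quotient `R(·, v)` at a fixed trial vector `v`: if `R(y', v) ≥ λ_k(y')` and
`R(y, v) ≤ λ_k(y)`, then `λ_k(y') - λ_k(y) ≤ R(y', v) - R(y, v)`, and the right hand side is a
derivative of `R(·, v)` by the mean value theorem. When `y, y' → x` and `v` converges to
a unit eigenvector `u` at `x`, the quotient of the right hand side tends to `R_x(x, u)` applied to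
the direction (`LocalAssumptions.tendsto_quotient_R`).

At a fixed parameter, minimization under orthogonality constraints gives orthonormal eigenvectors
`e_0, e_1, …` for `λ_1 ≤ λ_2 ≤ …`, and `R ≥ λ_{n+1}` on the orthogonal complement of any such
`e_0, …, e_{n-1}` (`exists_eigensystem`, `IsEigensystem.le_G`). By the compactness assumption,
such systems at `y → x` converge along subsequences, for the norm `N(x, ·)`, to a system
at `x`; hence the eigenvalues are continuous (`exists_eigensystem_limit`,
`continuousAt_eigenvalue`). Three choices of `v` then give everything.

* In the span of the first `k` eigenvectors at `y` there is a vector orthogonal to the first `k - 1`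
  eigenvectors at `y'`. Its limits are eigenvectors for `λ_k(x)`, by the equality case of
  `R ≤ λ_k` on the span of the first `k` eigenvectors. So the generalized upper derivative of `λ_k`
  is at most the maximum of `R_x(x, u)` over unit eigenvectors `u`; the lower derivative follows
  by exchanging `y` and `y'` (`eventually_quotient_le`, `eventually_le_quotient`).
* If `λ_k(x) < λ_{k+1}(x)`, each eigenvector `u` at `x` is a limit of vectors in the span of the
  first `k` eigenvectors at `x + t d` that are orthogonal to the eigenvectors at `x` for smaller
  eigenvalues. So the right derivative exists and is the maximum
  (`eventually_le_quotient_of_lt`).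
* If `λ_{k-1}(x) < λ_k(x)`, each eigenvector `u` at `x`, slightly corrected by eigenvectors for
  smaller eigenvalues, is orthogonal to the first `k - 1` eigenvectors at `x + t d`. So the right
  derivative exists and is the minimum (`eventually_quotient_le_of_lt`).

The bounds on the derivatives become inclusions in `C_k(x)` by Hahn-Banach. The separating functional
must be the evaluation at a vector of `X`, which is possible because `C_k(x)` is compact: the
unit eigenvectors form a compact set in a finite-dimensional space, on which `u ↦ R_x(x, u)` is
quadratic, and convex hulls of compact sets in finite dimension are compact (`isCompact_C`,
`exists_vector_separating`).
-/

set_option linter.unusedSectionVars false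

open scoped TensorProduct

noncomputable section

/-! ### Linear algebra -/

theorem Submodule.exists_ne_zero_forall_apply_eq_zero {M : Type*} [AddCommGroup M] [Module ℝ M]
    (E : Submodule ℝ M) {n : ℕ} (ℓ : Fin n → M →ₗ[ℝ] ℝ)
    (hE : FiniteDimensional ℝ E → n < Module.finrank ℝ E) :
    ∃ u ∈ E, u ≠ 0 ∧ ∀ i, ℓ i u = 0 := by
  by_contra! hcon
  have hinj : Function.Injective ((LinearMap.pi ℓ).comp E.subtype) := by
    rw [injective_iff_map_eq_zero]
    intro u hu
    by_contra hne
    obtain ⟨i, hi⟩ := hcon u u.2 (by simpa using hne)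
    exact hi (by simpa using congrFun hu i)
  have hfin : FiniteDimensional ℝ E := FiniteDimensional.of_injective _ hinj
  have := LinearMap.finrank_le_finrank_of_injective hinj
  simp at this
  have := hE hfin
  omega

theorem Submodule.exists_finrank_eq_of_not_finiteDimensional {M : Type*} [AddCommGroup M]
    [Module ℝ M] (hM : ¬ FiniteDimensional ℝ M) (n : ℕ) :
    ∃ E : Submodule ℝ M, Module.finrank ℝ E = n := by
  have h : (n : Cardinal) ≤ Module.rank ℝ M := by
    by_contra! hlt
    exact hM (Module.rank_lt_aleph0_iff.1 (hlt.trans (Cardinal.natCast_lt_aleph0)))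
  obtain ⟨s, hs, hli⟩ := le_rank_iff_exists_linearIndependent_finset.1 h
  refine ⟨Submodule.span ℝ (s : Set M), ?_⟩
  rw [finrank_span_finset_eq_card hli, hs]

theorem LinearMap.BilinForm.continuous_apply_self {V : Type*} [NormedAddCommGroup V]
    [NormedSpace ℝ V] [FiniteDimensional ℝ V] (b : LinearMap.BilinForm ℝ V) :
    Continuous fun a => b a a := by
  have h1 : Continuous (LinearMap.toContinuousLinearMap.toLinearMap ∘ₗ b) :=
    LinearMap.continuous_of_finiteDimensional _
  exact h1.clm_apply continuous_id

/-- On a finite-dimensional space every quadratic form is dominated by a positive definite one. -/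
theorem LinearMap.BilinForm.exists_apply_self_le_mul {V : Type*} [AddCommGroup V]
    [Module ℝ V] [FiniteDimensional ℝ V] (g q : LinearMap.BilinForm ℝ V)
    (hq : ∀ v, v ≠ 0 → 0 < q v v) : ∃ M : ℝ, ∀ v, g v v ≤ M * q v v := by
  let φ := (Module.finBasis ℝ V).equivFun
  let g' : LinearMap.BilinForm ℝ (Fin (Module.finrank ℝ V) → ℝ) := g.compl₁₂ φ.symm φ.symm
  let q' : LinearMap.BilinForm ℝ (Fin (Module.finrank ℝ V) → ℝ) := q.compl₁₂ φ.symm φ.symm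
  have hq' : ∀ a, a ≠ 0 → 0 < q' a a := fun a ha => hq _ (by simpa using ha)
  have hc : ContinuousOn (fun a => g' a a / q' a a)
      (Metric.sphere (0 : Fin (Module.finrank ℝ V) → ℝ) 1) :=
    g'.continuous_apply_self.continuousOn.div q'.continuous_apply_self.continuousOn
      fun a ha => (hq' a (ne_zero_of_mem_unit_sphere ⟨a, ha⟩)).ne'
  obtain ⟨M, hM⟩ := (isCompact_sphere _ _).bddAbove_image hc
  refine ⟨M, fun v => ?_⟩
  rcases eq_or_ne v 0 with rfl | hv
  · simp
  set a := φ v with ha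
  have ha0 : a ≠ 0 := by simpa [ha] using hv
  have hn : 0 < ‖a‖ := norm_pos_iff.2 ha0
  have hs : ‖a‖⁻¹ • a ∈ Metric.sphere (0 : Fin (Module.finrank ℝ V) → ℝ) 1 := by
    simp [norm_smul, hn.ne']
  have h1 := hM (mem_image_of_mem _ hs)
  have hgv : g v v = g' a a := by simp [g', ha]
  have hqv : q v v = q' a a := by simp [q', ha]
  have hpos := hq' a ha0
  rw [hgv, hqv]
  simp only [map_smul, LinearMap.smul_apply, smul_eq_mul] at h1
  rw [mul_div_mul_left _ _ (inv_ne_zero hn.ne'), mul_div_mul_left _ _ (inv_ne_zero hn.ne'),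
    div_le_iff₀ hpos] at h1
  exact h1

/-- The solutions of linear systems whose matrices tend to the identity matrix converge. -/
theorem Matrix.exists_tendsto_mulVec_eq {n : ℕ} {M : ℕ → Matrix (Fin n) (Fin n) ℝ}
    (hM : ∀ i j, Tendsto (fun m => M m i j) atTop (𝓝 ((1 : Matrix (Fin n) (Fin n) ℝ) i j)))
    {b : ℕ → Fin n → ℝ} {b₀ : Fin n → ℝ} (hb : ∀ i, Tendsto (fun m => b m i) atTop (𝓝 (b₀ i))) :
    ∃ c : ℕ → Fin n → ℝ, (∀ i, Tendsto (fun m => c m i) atTop (𝓝 (b₀ i))) ∧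
      ∀ᶠ m in atTop, ∀ i, ∑ j, M m i j * c m j = b m i := by
  have hM' : Tendsto M atTop (𝓝 1) :=
    tendsto_pi_nhds.2 fun i => tendsto_pi_nhds.2 fun j => hM i j
  have hdet : Tendsto (fun m => (M m).det) atTop (𝓝 1) := by
    have := ((continuous_id (X := Matrix (Fin n) (Fin n) ℝ)).matrix_det.tendsto 1).comp hM'
    simpa [Function.comp_def] using this
  have hadj : Tendsto (fun m => (M m).adjugate) atTop (𝓝 1) := by
    have := ((continuous_id (X := Matrix (Fin n) (Fin n) ℝ)).matrix_adjugate.tendsto 1).comp hM'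
    simpa [Function.comp_def] using this
  have hinv : Tendsto (fun m => (M m)⁻¹) atTop (𝓝 1) := by
    have h := (hdet.inv₀ one_ne_zero).smul hadj
    simpa [Matrix.inv_def] using h
  refine ⟨fun m => (M m)⁻¹.mulVec (b m), fun i => ?_, ?_⟩
  · have h : Tendsto (fun m => ∑ j, (M m)⁻¹ i j * b m j) atTop
        (𝓝 (∑ j, (1 : Matrix (Fin n) (Fin n) ℝ) i j * b₀ j)) :=
      tendsto_finsetSum _ fun j _ =>
        ((tendsto_pi_nhds.1 ((tendsto_pi_nhds.1 hinv) i)) j).mul (hb j)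
    have h2 : ∑ j, (1 : Matrix (Fin n) (Fin n) ℝ) i j * b₀ j = b₀ i := by
      simp [Matrix.one_apply]
    rw [h2] at h
    exact h
  · filter_upwards [hdet.eventually_ne one_ne_zero] with m hm i
    have : (M m).mulVec ((M m)⁻¹.mulVec (b m)) = b m := by
      rw [Matrix.mulVec_mulVec, Matrix.mul_nonsing_inv _ (isUnit_iff_ne_zero.2 hm),
        Matrix.one_mulVec]
    exact congrFun this i

/-! ### Bilinear forms -/

namespace RayleighData

variable {X Y : Type*} [AddCommGroup Y] [Module ℝ Y] {D : RayleighData X Y} {y : X}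

theorem B_self (y : X) (u : Y) : D.B y u u = D.Q y u :=
  QuadraticMap.associated_eq_self_apply ℝ _ u

theorem Γ_self (y : X) (u : D.H) : D.Γ y u u = D.G y u :=
  QuadraticMap.associated_eq_self_apply ℝ _ u

theorem B_comm (y : X) (u v : Y) : D.B y u v = D.B y v u :=
  (QuadraticMap.associated_isSymm ℝ (D.Q y)) u v

theorem Γ_comm (y : X) (u v : D.H) : D.Γ y u v = D.Γ y v u :=
  (QuadraticMap.associated_isSymm ℝ (D.G y)) u v

theorem Q_smul (y : X) (a : ℝ) (u : Y) : D.Q y (a • u) = a ^ 2 * D.Q y u := by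
  rw [QuadraticMap.map_smul, smul_eq_mul, sq]

theorem G_smul (y : X) (a : ℝ) (u : D.H) : D.G y (a • u) = a ^ 2 * D.G y u := by
  rw [QuadraticMap.map_smul, smul_eq_mul, sq]

theorem Q_add (y : X) (u v : Y) : D.Q y (u + v) = D.Q y u + 2 * D.B y u v + D.Q y v := by
  rw [← B_self, ← B_self, ← B_self, map_add, map_add, LinearMap.add_apply,
    LinearMap.add_apply, B_comm y v u]
  ring

theorem G_add (y : X) (u v : D.H) : D.G y (u + v) = D.G y u + 2 * D.Γ y u v + D.G y v := by
  rw [← Γ_self, ← Γ_self, ← Γ_self, map_add, map_add, LinearMap.add_apply,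
    LinearMap.add_apply, Γ_comm y v u]
  ring

theorem B_eq (y : X) (u v : Y) : D.B y u v = (D.Q y (u + v) - D.Q y u - D.Q y v) / 2 := by
  rw [Q_add]; ring

theorem Γ_eq (y : X) (u v : D.H) : D.Γ y u v = (D.G y (u + v) - D.G y u - D.G y v) / 2 := by
  rw [G_add]; ring

theorem R_smul (y : X) {a : ℝ} (ha : a ≠ 0) (u : D.H) : D.R y (a • u) = D.R y u := by
  rw [R, R, G_smul, Submodule.coe_smul, Q_smul, mul_div_mul_left _ _ (pow_ne_zero 2 ha)]

theorem Rx_smul [NormedAddCommGroup X] [NormedSpace ℝ X] (y : X) {a : ℝ} (ha : a ≠ 0)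
    (u : D.H) : D.Rx y (a • u) = D.Rx y u := by
  simp only [Rx, R_smul _ ha]

theorem Q_pos (hQ : (D.Q y).PosDef) {u : D.H} (hu : u ≠ 0) : 0 < D.Q y (u : Y) :=
  hQ _ (by simpa using hu)

theorem exists_smul_unit (hQ : (D.Q y).PosDef) {u : D.H} (hu : u ≠ 0) :
    ∃ a : ℝ, a ≠ 0 ∧ D.Q y ((a • u : D.H) : Y) = 1 := by
  have h := Q_pos hQ hu
  refine ⟨(Real.sqrt (D.Q y (u : Y)))⁻¹, inv_ne_zero (Real.sqrt_pos.2 h).ne', ?_⟩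
  rw [Submodule.coe_smul, Q_smul, inv_pow, Real.sq_sqrt h.le, inv_mul_cancel₀ h.ne']

/-- A subspace of dimension greater than `n` contains a unit vector that is orthogonal to
`n` given vectors. -/
theorem exists_unit_orthogonal (hQ : (D.Q y).PosDef) (E : Submodule ℝ D.H) {n : ℕ}
    (e : ℕ → D.H) (hE : FiniteDimensional ℝ E → n < Module.finrank ℝ E) :
    ∃ u ∈ E, D.Q y (u : Y) = 1 ∧ ∀ i < n, D.B y (e i : Y) (u : Y) = 0 := by
  obtain ⟨u, huE, hu, h⟩ := E.exists_ne_zero_forall_apply_eq_zero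
    (fun i : Fin n => (D.B y (e i : Y)).comp D.H.subtype) hE
  obtain ⟨a, -, h1⟩ := exists_smul_unit hQ hu
  refine ⟨a • u, E.smul_mem _ huE, h1, fun i hi => ?_⟩
  have := h ⟨i, hi⟩
  simp only [LinearMap.comp_apply, Submodule.subtype_apply] at this
  simp [this]

end RayleighData

namespace LinearMap.BilinForm

theorem apply_sum_self_of_diagonal {M : Type*} [AddCommGroup M] [Module ℝ M]
    (b : LinearMap.BilinForm ℝ M) {n : ℕ} {f : Fin n → M} {g : Fin n → ℝ}
    (h : ∀ i j, b (f i) (f j) = if i = j then g i else 0) (c : Fin n → ℝ) :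
    b (∑ i, c i • f i) (∑ i, c i • f i) = ∑ i, c i ^ 2 * g i := by
  simp only [map_sum, map_smul, LinearMap.sum_apply, LinearMap.smul_apply, smul_eq_mul, h,
    mul_ite, mul_zero, Finset.sum_ite_eq', Finset.mem_univ, if_true]
  exact Finset.sum_congr rfl fun i _ => by ring

end LinearMap.BilinForm

/-! ### Minimum-maximum principle at a fixed parameter -/

namespace RayleighData

section Algebra

variable {X Y : Type*} [AddCommGroup Y] [Module ℝ Y] {D : RayleighData X Y} {y : X}

/-- The form `B y` restricted to `H`. -/
def BH (D : RayleighData X Y) (y : X) : LinearMap.BilinForm ℝ D.H :=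
  (D.B y).compl₁₂ D.H.subtype D.H.subtype

theorem BH_apply (y : X) (u v : D.H) : D.BH y u v = D.B y (u : Y) (v : Y) := rfl

theorem BH_self (y : X) (u : D.H) : D.BH y u u = D.Q y (u : Y) := B_self _ _

theorem BH_comm (y : X) (u v : D.H) : D.BH y u v = D.BH y v u := B_comm _ _ _

/-- The first `n` vectors of the sequence `f` are orthonormal for `B y`. -/
def IsOrthonormal (D : RayleighData X Y) (y : X) (n : ℕ) (f : ℕ → D.H) : Prop :=
  ∀ i < n, ∀ j < n, D.BH y (f i) (f j) = if i = j then 1 else 0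

theorem IsOrthonormal.apply_sum {n : ℕ} {f : ℕ → D.H} (hf : D.IsOrthonormal y n f)
    (c : Fin n → ℝ) (j : Fin n) : D.BH y (∑ i, c i • f i) (f j) = c j := by
  have h : ∀ i : Fin n, D.BH y (f i) (f j) = if i = j then 1 else 0 := fun i => by
    rw [hf i i.2 j j.2]; simp [Fin.ext_iff]
  simp [map_sum, LinearMap.sum_apply, h]

theorem IsOrthonormal.Q_sum {n : ℕ} {f : ℕ → D.H} (hf : D.IsOrthonormal y n f)
    (c : Fin n → ℝ) : D.Q y ((∑ i, c i • f i : D.H) : Y) = ∑ i, c i ^ 2 := by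
  rw [← BH_self, (D.BH y).apply_sum_self_of_diagonal (g := fun _ => 1)]
  · simp
  · intro i j
    rw [hf i i.2 j j.2]; simp [Fin.ext_iff]

theorem IsOrthonormal.linearIndependent {n : ℕ} {f : ℕ → D.H} (hf : D.IsOrthonormal y n f) :
    LinearIndependent ℝ (fun i : Fin n => f i) := by
  rw [Fintype.linearIndependent_iff]
  intro c hc i
  have := hf.apply_sum c i
  rw [hc] at this
  simpa using this.symm

theorem IsOrthonormal.finrank_span {n : ℕ} {f : ℕ → D.H} (hf : D.IsOrthonormal y n f) :
    Module.finrank ℝ (Submodule.span ℝ (range fun i : Fin n => f i)) = n := by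
  simpa using finrank_span_eq_card hf.linearIndependent

end Algebra

variable {X Y : Type*} [NormedAddCommGroup X] [NormedSpace ℝ X] [AddCommGroup Y] [Module ℝ Y]
variable {D : RayleighData X Y} {Ω : Set X} {y : X}

theorem LocalAssumptions.form_nonneg {x : X} {V : Set X} {θ : X → ℝ}
    (h : D.LocalAssumptions Ω x V θ) (hy : y ∈ V) (v : D.H) :
    0 ≤ D.G y v + θ y * D.Q y (v : Y) := by
  rcases eq_or_ne v 0 with rfl | hv
  · simp
  · exact (h.N_posDef y hy v hv).le

theorem LocalAssumptions.mem {x : X} {V : Set X} {θ : X → ℝ}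
    (h : D.LocalAssumptions Ω x V θ) : x ∈ V := mem_of_mem_nhds h.nhd

theorem StandingAssumptions.exists_neg_mul_le (hD : D.StandingAssumptions Ω) (hy : y ∈ Ω) :
    ∃ M : ℝ, ∀ v : D.H, -M * D.Q y (v : Y) ≤ D.G y v := by
  obtain ⟨V, θ, h⟩ := hD.loc y hy
  exact ⟨θ y, fun v => by linarith [h.form_nonneg h.mem v]⟩

theorem bddAbove_R (hQ : (D.Q y).PosDef) (E : Submodule ℝ D.H) [FiniteDimensional ℝ E] :
    BddAbove (range fun u : {u : D.H // u ∈ E ∧ D.Q y (u : Y) = 1} => D.R y u.1) := by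
  obtain ⟨M, hM⟩ := LinearMap.BilinForm.exists_apply_self_le_mul
    ((D.Γ y).compl₁₂ E.subtype E.subtype) ((D.BH y).compl₁₂ E.subtype E.subtype)
    (fun v hv => by
      simp only [LinearMap.compl₁₂_apply, Submodule.subtype_apply, BH_self]
      exact Q_pos hQ (by simpa using hv))
  refine ⟨M, ?_⟩
  rintro _ ⟨⟨u, huE, hu⟩, rfl⟩
  have := hM ⟨u, huE⟩
  simp only [LinearMap.compl₁₂_apply, Submodule.subtype_apply, BH_self, Γ_self, hu] at this
  simpa [R, hu] using this

theorem le_iSup_R (hQ : (D.Q y).PosDef) {E : Submodule ℝ D.H} [FiniteDimensional ℝ E] {u : D.H}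
    (huE : u ∈ E) (hu : D.Q y (u : Y) = 1) :
    D.G y u ≤ ⨆ u : {u : D.H // u ∈ E ∧ D.Q y (u : Y) = 1}, D.R y u.1 := by
  have := le_ciSup (bddAbove_R hQ E) ⟨u, huE, hu⟩
  simpa [R, hu] using this

theorem eigenvalue_le (hD : D.StandingAssumptions Ω) (hy : y ∈ Ω) {n : ℕ}
    {E : Submodule ℝ D.H} (hE : Module.finrank ℝ E = n + 1) {μ : ℝ}
    (hμ : ∀ u ∈ E, D.G y u ≤ μ * D.Q y (u : Y)) : D.eigenvalue (n + 1) y ≤ μ := by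
  have hQ := hD.posDef y hy
  obtain ⟨M, hM⟩ := hD.exists_neg_mul_le hy
  have hunit : ∀ E : Submodule ℝ D.H, Module.finrank ℝ E = n + 1 →
      ∃ u ∈ E, D.Q y (u : Y) = 1 := fun E hE => by
    obtain ⟨u, h1, h2, -⟩ := exists_unit_orthogonal (n := 0) hQ E (fun _ => 0)
      (fun _ => by omega)
    exact ⟨u, h1, h2⟩
  have hbdd : BddBelow (range fun E : {E : Submodule ℝ D.H // Module.finrank ℝ E = n + 1} =>
      ⨆ u : {u : D.H // u ∈ E.1 ∧ D.Q y (u : Y) = 1}, D.R y u.1) := by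
    refine ⟨-M, ?_⟩
    rintro _ ⟨⟨E, hE⟩, rfl⟩
    obtain ⟨u, huE, hu⟩ := hunit E hE
    have : FiniteDimensional ℝ E := FiniteDimensional.of_finrank_pos (by omega)
    have h1 := hM u
    rw [hu, mul_one] at h1
    exact h1.trans (le_iSup_R hQ huE hu)
  obtain ⟨u, huE, hu⟩ := hunit E hE
  have : Nonempty {u : D.H // u ∈ E ∧ D.Q y (u : Y) = 1} := ⟨⟨u, huE, hu⟩⟩
  refine (ciInf_le hbdd ⟨E, hE⟩).trans (ciSup_le ?_)
  rintro ⟨v, hvE, hv⟩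
  simpa [R, hv] using hμ v hvE

theorem le_eigenvalue (hD : D.StandingAssumptions Ω) (hH : ¬ FiniteDimensional ℝ D.H)
    (hy : y ∈ Ω) {n : ℕ} {μ : ℝ}
    (hμ : ∀ E : Submodule ℝ D.H, Module.finrank ℝ E = n + 1 →
      ∃ u ∈ E, D.Q y (u : Y) = 1 ∧ μ ≤ D.G y u) : μ ≤ D.eigenvalue (n + 1) y := by
  obtain ⟨E, hE⟩ := Submodule.exists_finrank_eq_of_not_finiteDimensional hH (n + 1)
  have : Nonempty {E : Submodule ℝ D.H // Module.finrank ℝ E = n + 1} := ⟨⟨E, hE⟩⟩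
  refine le_ciInf ?_
  rintro ⟨E, hE⟩
  have : FiniteDimensional ℝ E := FiniteDimensional.of_finrank_pos (by omega)
  obtain ⟨u, huE, hu, h⟩ := hμ E hE
  exact h.trans (le_iSup_R (hD.posDef y hy) huE hu)

/-- Upper bound for an eigenvalue by the values of `G` on an orthonormal family that also
diagonalizes `G`. -/
theorem eigenvalue_le_of_diagonal (hD : D.StandingAssumptions Ω) (hy : y ∈ Ω) {n : ℕ}
    {f : ℕ → D.H} (hf : D.IsOrthonormal y (n + 1) f)
    (hΓ : ∀ i < n + 1, ∀ j < n + 1, i ≠ j → D.Γ y (f i) (f j) = 0) {μ : ℝ}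
    (hμ : ∀ i < n + 1, D.G y (f i) ≤ μ) : D.eigenvalue (n + 1) y ≤ μ := by
  refine eigenvalue_le hD hy hf.finrank_span fun u hu => ?_
  obtain ⟨c, rfl⟩ := (Submodule.mem_span_range_iff_exists_fun ℝ).1 hu
  rw [hf.Q_sum, ← Γ_self, (D.Γ y).apply_sum_self_of_diagonal (g := fun i => D.G y (f i)),
    Finset.mul_sum]
  · refine Finset.sum_le_sum fun i _ => ?_
    rw [mul_comm]
    exact mul_le_mul_of_nonneg_right (hμ i i.2) (sq_nonneg _)
  · intro i j
    split_ifs with hij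
    · rw [hij, Γ_self]
    · exact hΓ i i.2 j j.2 (by simpa [Fin.ext_iff] using hij)

/-- The first `n` vectors of the sequence `e` are orthonormal eigenvectors for the first `n`
eigenvalues at `y`. The eigenvalue of `e i` is number `i + 1`, since eigenvalues are numbered
from `1`. -/
structure IsEigensystem (D : RayleighData X Y) (y : X) (n : ℕ) (e : ℕ → D.H) : Prop where
  orthonormal : D.IsOrthonormal y n e
  eigen : ∀ i < n, ∀ v, D.Γ y (e i) v = D.eigenvalue (i + 1) y * D.BH y (e i) v

namespace IsEigensystem

variable {n : ℕ} {e : ℕ → D.H}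

theorem mono (h : D.IsEigensystem y n e) {m : ℕ} (hm : m ≤ n) : D.IsEigensystem y m e :=
  ⟨fun i hi j hj => h.orthonormal i (hi.trans_le hm) j (hj.trans_le hm),
    fun i hi => h.eigen i (hi.trans_le hm)⟩

theorem Q_eq (h : D.IsEigensystem y n e) {i : ℕ} (hi : i < n) : D.Q y (e i : Y) = 1 := by
  rw [← BH_self, h.orthonormal i hi i hi, if_pos rfl]

theorem G_eq (h : D.IsEigensystem y n e) {i : ℕ} (hi : i < n) :
    D.G y (e i) = D.eigenvalue (i + 1) y := by
  rw [← Γ_self, h.eigen i hi, BH_self, h.Q_eq hi, mul_one]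

theorem Γ_sum (h : D.IsEigensystem y n e) (c : Fin n → ℝ) (v : D.H) :
    D.Γ y (∑ i, c i • e i) v = ∑ i : Fin n, c i * D.eigenvalue (i + 1) y * D.BH y (e i) v := by
  simp only [map_sum, map_smul, LinearMap.sum_apply, LinearMap.smul_apply, smul_eq_mul]
  exact Finset.sum_congr rfl fun i _ => by rw [h.eigen i i.2, mul_assoc]

theorem G_sum (h : D.IsEigensystem y n e) (c : Fin n → ℝ) :
    D.G y (∑ i, c i • e i) = ∑ i : Fin n, c i ^ 2 * D.eigenvalue (i + 1) y := by
  rw [← Γ_self, h.Γ_sum]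
  refine Finset.sum_congr rfl fun i _ => ?_
  rw [BH_comm, h.orthonormal.apply_sum]
  ring

/-- A vector that is orthogonal to the first `n` eigenvectors has a Rayleigh quotient at least
the eigenvalue number `n + 1`. Otherwise, with `i` minimal such that the quotient is below
the eigenvalue number `i + 1`, the vector and the first `i` eigenvectors span a trial space that
contradicts the definition of that eigenvalue. -/
theorem le_G (hD : D.StandingAssumptions Ω) (hy : y ∈ Ω) (h : D.IsEigensystem y n e) {v : D.H}
    (hv : ∀ i < n, D.BH y (e i) v = 0) :
    D.eigenvalue (n + 1) y * D.Q y (v : Y) ≤ D.G y v := by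
  rcases eq_or_ne v 0 with rfl | hv0
  · simp
  have hQ := hD.posDef y hy
  obtain ⟨a, ha, hav⟩ := exists_smul_unit hQ hv0
  set w := a • v with hw
  have hwe : ∀ i < n, D.BH y (e i) w = 0 := fun i hi => by simp [hw, hv i hi]
  have key : ∀ i ≤ n, D.eigenvalue (i + 1) y ≤ D.G y w := by
    intro i
    induction i using Nat.strong_induction_on with
    | _ i ih =>
    intro hi
    have hlt : ∀ j < i + 1, j ≠ i → j < i := fun j hj hji => by omega
    refine eigenvalue_le_of_diagonal (f := Function.update e i w) hD hy ?_ ?_ ?_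
    · intro j hj l hl
      rcases eq_or_ne j i with rfl | hji <;> rcases eq_or_ne l j with rfl | hlj
      · simp [BH_self, hav]
      · rw [Function.update_self, Function.update_of_ne hlj, if_neg hlj.symm, BH_comm]
        exact hwe l (by omega)
      · rw [Function.update_of_ne hji, h.orthonormal l (by omega) l (by omega)]
      · rw [Function.update_of_ne hji]
        rcases eq_or_ne l i with rfl | hli
        · rw [Function.update_self, if_neg hlj.symm]
          exact hwe j (by omega)
        · rw [Function.update_of_ne hli, h.orthonormal j (by omega) l (by omega)]
    · intro j hj l hl hjl
      rcases eq_or_ne j i with rfl | hji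
      · rw [Function.update_self, Function.update_of_ne hjl.symm, Γ_comm,
          h.eigen l (by omega), hwe l (by omega), mul_zero]
      · rw [Function.update_of_ne hji, h.eigen j (by omega)]
        rcases eq_or_ne l i with rfl | hli
        · rw [Function.update_self, hwe j (by omega), mul_zero]
        · rw [Function.update_of_ne hli, h.orthonormal j (by omega) l (by omega), if_neg hjl,
            mul_zero]
    · intro j hj
      rcases eq_or_ne j i with rfl | hji
      · rw [Function.update_self]
      · rw [Function.update_of_ne hji, h.G_eq (by omega)]
        exact ih j (by omega) (by omega)
  have h1 := key n le_rfl
  rw [Submodule.coe_smul, Q_smul] at hav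
  rw [hw, G_smul] at h1
  have ha2 : 0 < a ^ 2 := by positivity
  have : a ^ 2 * (D.eigenvalue (n + 1) y * D.Q y (v : Y)) ≤ a ^ 2 * D.G y v := by
    calc _ = D.eigenvalue (n + 1) y * (a ^ 2 * D.Q y (v : Y)) := by ring
      _ = D.eigenvalue (n + 1) y := by rw [hav, mul_one]
      _ ≤ _ := h1
  exact le_of_mul_le_mul_left this ha2

theorem eigenvalue_mono (hD : D.StandingAssumptions Ω) (hy : y ∈ Ω) (h : D.IsEigensystem y n e)
    {i j : ℕ} (hij : i ≤ j) (hj : j < n) : D.eigenvalue (i + 1) y ≤ D.eigenvalue (j + 1) y := by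
  have h1 := (h.mono (m := i) (by omega)).le_G hD hy (v := e j) fun l hl => by
    rw [h.orthonormal l (by omega) j hj, if_neg (by omega)]
  rwa [h.Q_eq hj, mul_one, h.G_eq hj] at h1

theorem G_sum_le (hD : D.StandingAssumptions Ω) (hy : y ∈ Ω) (h : D.IsEigensystem y (n + 1) e)
    (c : Fin (n + 1) → ℝ) :
    D.G y (∑ i, c i • e i) ≤
      D.eigenvalue (n + 1) y * D.Q y ((∑ i, c i • e i : D.H) : Y) := by
  rw [h.G_sum, h.orthonormal.Q_sum, Finset.mul_sum]
  refine Finset.sum_le_sum fun i _ => ?_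
  rw [mul_comm]
  exact mul_le_mul_of_nonneg_right
    (h.eigenvalue_mono hD hy (Nat.lt_succ_iff.1 i.2) (Nat.lt_succ_self n)) (sq_nonneg _)

/-- A combination of the first `n + 1` eigenvectors whose Rayleigh quotient is the eigenvalue
number `n + 1` is an eigenvector for that eigenvalue. -/
theorem sum_mem_eigenspace (hD : D.StandingAssumptions Ω) (hy : y ∈ Ω)
    (h : D.IsEigensystem y (n + 1) e) (c : Fin (n + 1) → ℝ)
    (hc : D.eigenvalue (n + 1) y * D.Q y ((∑ i, c i • e i : D.H) : Y) ≤ D.G y (∑ i, c i • e i)) :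
    ∑ i, c i • e i ∈ D.eigenspace (n + 1) y := by
  rw [h.G_sum, h.orthonormal.Q_sum, Finset.mul_sum] at hc
  have hle : ∀ i : Fin (n + 1), 0 ≤ (D.eigenvalue (n + 1) y - D.eigenvalue (i + 1) y) * c i ^ 2 :=
    fun i => mul_nonneg (sub_nonneg.2
      (h.eigenvalue_mono hD hy (Nat.lt_succ_iff.1 i.2) (Nat.lt_succ_self n))) (sq_nonneg _)
  have hsum : ∑ i : Fin (n + 1),
      (D.eigenvalue (n + 1) y - D.eigenvalue (i + 1) y) * c i ^ 2 = 0 := by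
    refine le_antisymm ?_ (Finset.sum_nonneg fun i _ => hle i)
    have : ∑ i : Fin (n + 1), (D.eigenvalue (n + 1) y - D.eigenvalue (i + 1) y) * c i ^ 2 =
        ∑ i, D.eigenvalue (n + 1) y * c i ^ 2 -
          ∑ i : Fin (n + 1), c i ^ 2 * D.eigenvalue (i + 1) y := by
      rw [← Finset.sum_sub_distrib]
      exact Finset.sum_congr rfl fun i _ => by ring
    rw [this]; linarith
  have hzero := (Finset.sum_eq_zero_iff_of_nonneg fun i _ => hle i).1 hsum
  intro v
  rw [map_smul, LinearMap.smul_apply, smul_eq_mul, ← BH_apply, h.Γ_sum]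
  simp only [map_sum, map_smul, LinearMap.sum_apply, LinearMap.smul_apply, smul_eq_mul,
    Finset.mul_sum]
  refine Finset.sum_congr rfl fun i _ => ?_
  rcases mul_eq_zero.1 (hzero i (Finset.mem_univ i)) with h0 | h0
  · rw [sub_eq_zero.1 h0]; ring
  · rw [pow_eq_zero_iff two_ne_zero] at h0
    rw [h0]; ring

end IsEigensystem

theorem mem_eigenspace_iff {k : ℕ} {u : D.H} :
    u ∈ D.eigenspace k y ↔ ∀ v, D.Γ y u v = D.eigenvalue k y * D.BH y u v := by
  simp [eigenspace, OperatorMapsTo, BH_apply]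

theorem G_eq_of_mem_unitEigenvectors {k : ℕ} {u : D.H} (hu : u ∈ D.unitEigenvectors k y) :
    D.G y u = D.eigenvalue k y := by
  rw [← Γ_self, mem_eigenspace_iff.1 hu.1, BH_self, hu.2, mul_one]

end RayleighData

/-! ### Continuity in the parameter and in the vector -/

namespace RayleighData

variable {X Y : Type*} [NormedAddCommGroup X] [NormedSpace ℝ X] [AddCommGroup Y] [Module ℝ Y]
variable {D : RayleighData X Y} {Ω : Set X} {x y : X} {V : Set X} {θ : X → ℝ}

/-- The square of the norm `N`. -/
def energy (D : RayleighData X Y) (θ : X → ℝ) (y : X) (v : D.H) : ℝ :=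
  D.G y v + θ y * D.Q y (v : Y)

theorem energy_smul (a : ℝ) (v : D.H) : D.energy θ y (a • v) = a ^ 2 * D.energy θ y v := by
  rw [energy, energy, G_smul, Submodule.coe_smul, Q_smul]; ring

theorem energy_add (u v : D.H) : D.energy θ y (u + v) =
    D.energy θ y u + 2 * (D.Γ y u v + θ y * D.BH y u v) + D.energy θ y v := by
  rw [energy, energy, energy, G_add, Submodule.coe_add, Q_add, BH_apply]; ring

theorem energy_sub (u v : D.H) : D.energy θ y (u - v) =
    D.energy θ y u - 2 * (D.Γ y u v + θ y * D.BH y u v) + D.energy θ y v := by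
  have h := energy_smul (D := D) (θ := θ) (y := y) (-1) v
  rw [sub_eq_add_neg, energy_add, ← neg_one_smul ℝ v, h]
  simp; ring

/-- Convergence of a sequence in `H` for the norm `N(x, ·)`. -/
def TendstoEnergy (D : RayleighData X Y) (θ : X → ℝ) (x : X) (u : ℕ → D.H) (u₀ : D.H) : Prop :=
  Tendsto (fun n => D.energy θ x (u n - u₀)) atTop (𝓝 0)

theorem TendstoEnergy.comp {u : ℕ → D.H} {u₀ : D.H} (hu : D.TendstoEnergy θ x u u₀) {φ : ℕ → ℕ}
    (hφ : Tendsto φ atTop atTop) : D.TendstoEnergy θ x (fun n => u (φ n)) u₀ :=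
  Tendsto.comp hu hφ

theorem tendstoEnergy_const (u : D.H) : D.TendstoEnergy θ x (fun _ => u) u := by
  simp [TendstoEnergy, energy]

namespace LocalAssumptions

variable (h : D.LocalAssumptions Ω x V θ)
include h

theorem energy_nonneg (hy : y ∈ V) (v : D.H) : 0 ≤ D.energy θ y v := h.form_nonneg hy v

theorem N_sq (hy : y ∈ V) (v : D.H) : D.N θ y v ^ 2 = D.energy θ y v :=
  Real.sq_sqrt (h.energy_nonneg hy v)

theorem energy_add_le (hy : y ∈ V) (u v : D.H) :
    D.energy θ y (u + v) ≤ 2 * D.energy θ y u + 2 * D.energy θ y v := by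
  have h1 := h.energy_nonneg hy (u - v)
  rw [energy_sub] at h1
  rw [energy_add]
  linarith

theorem tendstoEnergy_add {u v : ℕ → D.H} {u₀ v₀ : D.H} (hu : D.TendstoEnergy θ x u u₀)
    (hv : D.TendstoEnergy θ x v v₀) :
    D.TendstoEnergy θ x (fun n => u n + v n) (u₀ + v₀) := by
  have h1 : Tendsto (fun n => 2 * D.energy θ x (u n - u₀) + 2 * D.energy θ x (v n - v₀)) atTop
      (𝓝 0) := by simpa using (hu.const_mul 2).add (hv.const_mul 2)
  refine squeeze_zero (fun n => h.energy_nonneg h.mem _) (fun n => ?_) h1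
  rw [add_sub_add_comm]
  exact h.energy_add_le h.mem _ _

theorem tendstoEnergy_smul {c : ℕ → ℝ} {c₀ : ℝ} {u : ℕ → D.H} {u₀ : D.H}
    (hc : Tendsto c atTop (𝓝 c₀)) (hu : D.TendstoEnergy θ x u u₀) :
    D.TendstoEnergy θ x (fun n => c n • u n) (c₀ • u₀) := by
  have h1 : Tendsto (fun n => 2 * (c n ^ 2 * D.energy θ x (u n - u₀)) +
      2 * ((c n - c₀) ^ 2 * D.energy θ x u₀)) atTop (𝓝 0) := by
    have h2 := ((hc.pow 2).mul hu).const_mul 2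
    have h3 := (((hc.sub_const c₀).pow 2).mul_const (D.energy θ x u₀)).const_mul 2
    simpa using h2.add h3
  refine squeeze_zero (fun n => h.energy_nonneg h.mem _) (fun n => ?_) h1
  have : c n • u n - c₀ • u₀ = c n • (u n - u₀) + (c n - c₀) • u₀ := by
    rw [smul_sub, sub_smul]; abel
  rw [this, ← energy_smul, ← energy_smul]
  exact h.energy_add_le h.mem _ _

theorem tendstoEnergy_sum {m : ℕ} {c : ℕ → Fin m → ℝ} {c₀ : Fin m → ℝ} {u : ℕ → ℕ → D.H}
    {u₀ : ℕ → D.H} (hc : ∀ i, Tendsto (fun n => c n i) atTop (𝓝 (c₀ i)))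
    (hu : ∀ i < m, D.TendstoEnergy θ x (fun n => u n i) (u₀ i)) :
    D.TendstoEnergy θ x (fun n => ∑ i, c n i • u n i) (∑ i, c₀ i • u₀ i) := by
  induction m with
  | zero => simpa using tendstoEnergy_const (0 : D.H)
  | succ m ih =>
    simp only [Fin.sum_univ_castSucc]
    exact h.tendstoEnergy_add (ih (c := fun n i => c n i.castSucc)
      (fun i => hc _) fun i hi => hu i (by omega))
      (h.tendstoEnergy_smul (hc _) (hu m (by omega)))

/-- The forms `energy y` are equivalent, uniformly in `y`. -/
theorem exists_energy_le : ∃ K : ℝ, 0 < K ∧ ∀ y ∈ V, ∀ v : D.H,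
    D.energy θ y v ≤ K * D.energy θ x v ∧ D.energy θ x v ≤ K * D.energy θ y v := by
  obtain ⟨C, hC, hN⟩ := h.N_equiv
  have hC0 : 0 < C := by linarith
  refine ⟨C ^ 2, by positivity, fun y hy v => ?_⟩
  obtain ⟨h1, h2⟩ := hN y hy v
  rw [inv_mul_le_iff₀ hC0] at h1
  rw [← h.N_sq hy, ← h.N_sq h.mem, ← mul_pow, ← mul_pow]
  exact ⟨pow_le_pow_left₀ (Real.sqrt_nonneg _) h1 2, pow_le_pow_left₀ (Real.sqrt_nonneg _) h2 2⟩

/-- `Q y v` varies with `y` at a rate bounded by `N(x, v)²`, by the bound for the derivative. -/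
theorem exists_abs_Q_sub_le (hD : D.StandingAssumptions Ω) : ∃ K : ℝ, ∀ᶠ z in 𝓝 x, ∀ v : D.H,
    |D.Q z (v : Y) - D.Q x (v : Y)| ≤ K * D.energy θ x v * ‖z - x‖ := by
  obtain ⟨K, hK, hE⟩ := h.exists_energy_le
  obtain ⟨C₀, hC₀, hb⟩ := h.bound
  obtain ⟨r, hr, hball⟩ := Metric.mem_nhds_iff.1 h.nhd
  refine ⟨C₀ * K, ?_⟩
  filter_upwards [Metric.ball_mem_nhds x hr] with z hz v
  refine Convex.norm_image_sub_le_of_norm_fderiv_le (𝕜 := ℝ) (s := Metric.ball x r)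
    (f := fun z => D.Q z (v : Y)) (fun w hw => ?_) (fun w hw => ?_) (convex_ball x r)
    (Metric.mem_ball_self hr) hz
  · obtain ⟨V', θ', h'⟩ := hD.loc w (h.subset (hball hw))
    exact h'.differentiable_Q _
  · have h1 := (hb w (hball hw) v v).1
    simp only [B_self] at h1
    refine h1.trans ?_
    rw [mul_assoc, ← sq, h.N_sq (hball hw), mul_assoc]
    exact mul_le_mul_of_nonneg_left (hE w (hball hw) v).1 hC₀.le

/-- Convergence for `N(x, ·)` implies convergence for `Q(xs n, ·)`. The function `θ` may tend to `0`
along `xs`, so that this does not follow from the equivalence of the norms `N` alone. -/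
theorem tendsto_Q_zero (hD : D.StandingAssumptions Ω) {xs : ℕ → X} (hxs : Tendsto xs atTop (𝓝 x))
    {w : ℕ → D.H} (hw : Tendsto (fun n => D.energy θ x (w n)) atTop (𝓝 0)) :
    Tendsto (fun n => D.Q (xs n) (w n : Y)) atTop (𝓝 0) := by
  have hN : Tendsto (fun n => D.N θ x (w n - 0)) atTop (𝓝 0) := by
    have := (Real.continuous_sqrt.tendsto 0).comp hw
    simpa [Function.comp_def, N, energy] using this
  have hG := (h.continuity_G (fun _ => x) w 0 (fun _ => h.mem) tendsto_const_nhds hN).1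
  have hQx : Tendsto (fun n => D.Q x (w n : Y)) atTop (𝓝 0) := by
    have h1 := (hw.sub hG).const_mul (θ x)⁻¹
    have h2 : (θ x)⁻¹ * (0 - D.G x 0) = 0 := by simp
    rw [h2] at h1
    refine h1.congr fun n => ?_
    rw [energy, add_sub_cancel_left, inv_mul_cancel_left₀ (h.θ_pos x h.mem).ne']
  obtain ⟨K, hK⟩ := h.exists_abs_Q_sub_le hD
  have hd : Tendsto (fun n => K * D.energy θ x (w n) * ‖xs n - x‖) atTop (𝓝 0) := by
    have h1 : Tendsto (fun n => ‖xs n - x‖) atTop (𝓝 0) := by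
      simpa using (hxs.sub_const x).norm
    simpa using (hw.const_mul K).mul h1
  have hdiff : Tendsto (fun n => D.Q (xs n) (w n : Y) - D.Q x (w n : Y)) atTop (𝓝 0) :=
    squeeze_zero_norm' ((hxs.eventually hK).mono fun n hn => hn (w n)) hd
  simpa using hdiff.add hQx

/-- Joint continuity of the forms and of their derivatives in the parameter. -/
theorem tendsto_forms (hD : D.StandingAssumptions Ω) {xs : ℕ → X}
    (hxs : Tendsto xs atTop (𝓝 x)) {u : ℕ → D.H} {u₀ : D.H} (hu : D.TendstoEnergy θ x u u₀) :
    (Tendsto (fun n => D.Q (xs n) (u n : Y)) atTop (𝓝 (D.Q x (u₀ : Y))) ∧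
    Tendsto (fun n => fderiv ℝ (fun y => D.Q y (u n : Y)) (xs n)) atTop
      (𝓝 (fderiv ℝ (fun y => D.Q y (u₀ : Y)) x))) ∧
    Tendsto (fun n => D.G (xs n) (u n)) atTop (𝓝 (D.G x u₀)) ∧
    Tendsto (fun n => fderiv ℝ (fun y => D.G y (u n)) (xs n)) atTop
      (𝓝 (fderiv ℝ (fun y => D.G y u₀) x)) := by
  -- Terms outside `V` are replaced by `x`: only finitely many are.
  classical
  wlog hV : ∀ n, xs n ∈ V generalizing xs
  · let xs' : ℕ → X := fun n => if xs n ∈ V then xs n else x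
    have heq : ∀ᶠ n in atTop, xs' n = xs n :=
      (hxs.eventually h.nhd).mono fun n hn => if_pos hn
    have hxs' : Tendsto xs' atTop (𝓝 x) := hxs.congr' (heq.mono fun n hn => hn.symm)
    have hV' : ∀ n, xs' n ∈ V := fun n => by
      simp only [xs']; split_ifs with hn
      exacts [hn, h.mem]
    obtain ⟨⟨h1, h2⟩, h3, h4⟩ := this hxs' hV'
    exact ⟨⟨h1.congr' (heq.mono fun n hn => by rw [hn]),
      h2.congr' (heq.mono fun n hn => by rw [hn])⟩,
      h3.congr' (heq.mono fun n hn => by rw [hn]), h4.congr' (heq.mono fun n hn => by rw [hn])⟩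
  have hQ := h.tendsto_Q_zero hD hxs hu
  obtain ⟨K, hK, hE⟩ := h.exists_energy_le
  have hen : Tendsto (fun n => D.energy θ (xs n) (u n - u₀)) atTop (𝓝 0) := by
    refine squeeze_zero (fun n => h.energy_nonneg (hV n) _) (fun n => (hE _ (hV n) _).1) ?_
    simpa using hu.const_mul K
  have hN : Tendsto (fun n => D.N θ (xs n) (u n - u₀)) atTop (𝓝 0) := by
    have := (Real.continuous_sqrt.tendsto 0).comp hen
    simpa [Function.comp_def, N, energy] using this
  exact ⟨h.continuity_Q xs (fun n => (u n : Y)) u₀ hV hxs (by simpa using hQ),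
    h.continuity_G xs u u₀ hV hxs hN⟩

theorem tendsto_BH (hD : D.StandingAssumptions Ω) {xs : ℕ → X}
    (hxs : Tendsto xs atTop (𝓝 x)) {u v : ℕ → D.H} {u₀ v₀ : D.H}
    (hu : D.TendstoEnergy θ x u u₀) (hv : D.TendstoEnergy θ x v v₀) :
    Tendsto (fun n => D.BH (xs n) (u n) (v n)) atTop (𝓝 (D.BH x u₀ v₀)) := by
  have h1 := (h.tendsto_forms hD hxs (h.tendstoEnergy_add hu hv)).1.1
  have h2 := (h.tendsto_forms hD hxs hu).1.1
  have h3 := (h.tendsto_forms hD hxs hv).1.1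
  have := ((h1.sub h2).sub h3).div_const 2
  simpa only [BH_apply, B_eq, Submodule.coe_add] using this

end LocalAssumptions

namespace StandingAssumptions

variable (hD : D.StandingAssumptions Ω)
include hD

theorem hasFDerivAt_R (hy : y ∈ Ω) {u : D.H} (hu : u ≠ 0) :
    HasFDerivAt (fun y => D.R y u) ((D.Q y (u : Y))⁻¹ • (fderiv ℝ (fun y => D.G y u) y -
      D.R y u • fderiv ℝ (fun y => D.Q y (u : Y)) y)) y := by
  obtain ⟨V, θ, h⟩ := hD.loc y hy
  have hQ := (Q_pos (hD.posDef y hy) hu).ne'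
  have h1 := (h.differentiable_G u).hasFDerivAt
  have h2 := (h.differentiable_Q u).hasFDerivAt
  have h3 := h1.mul ((hasDerivAt_inv hQ).comp_hasFDerivAt y h2)
  refine h3.congr_fderiv ?_
  ext w
  simp [R]
  field_simp
  ring

theorem Rx_eq (hy : y ∈ Ω) {u : D.H} (hu : u ≠ 0) :
    D.Rx y u = (D.Q y (u : Y))⁻¹ • (fderiv ℝ (fun y => D.G y u) y -
      D.R y u • fderiv ℝ (fun y => D.Q y (u : Y)) y) :=
  (hD.hasFDerivAt_R hy hu).fderiv

end StandingAssumptions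

namespace LocalAssumptions

variable (h : D.LocalAssumptions Ω x V θ)
include h

theorem eventually_ne_zero (hD : D.StandingAssumptions Ω) {u : ℕ → D.H} {u₀ : D.H}
    (hu : D.TendstoEnergy θ x u u₀) (hu₀ : u₀ ≠ 0) : ∀ᶠ n in atTop, u n ≠ 0 := by
  have h1 := (h.tendsto_forms hD (tendsto_const_nhds (x := x)) hu).1.1
  filter_upwards [h1.eventually_ne (Q_pos (hD.posDef x (h.subset h.mem)) hu₀).ne'] with n hn h0
  simp [h0] at hn

theorem tendsto_Rx (hD : D.StandingAssumptions Ω) {xs : ℕ → X}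
    (hxs : Tendsto xs atTop (𝓝 x)) {u : ℕ → D.H} {u₀ : D.H}
    (hu : D.TendstoEnergy θ x u u₀) (hu₀ : u₀ ≠ 0) :
    Tendsto (fun n => D.Rx (xs n) (u n)) atTop (𝓝 (D.Rx x u₀)) := by
  have hx := h.subset h.mem
  have hQ := (Q_pos (hD.posDef x hx) hu₀).ne'
  obtain ⟨⟨h1, h2⟩, h3, h4⟩ := h.tendsto_forms hD hxs hu
  have h5 := (h1.inv₀ hQ).smul (h4.sub ((h3.div h1 hQ).smul h2))
  rw [hD.Rx_eq hx hu₀]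
  refine h5.congr' ?_
  filter_upwards [hxs.eventually h.nhd, h.eventually_ne_zero hD hu hu₀] with n hn hn0
  rw [hD.Rx_eq (h.subset hn) hn0]
  rfl

/-- Difference quotients of `R` in the parameter, at moving base points and vectors. -/
theorem tendsto_quotient_R (hD : D.StandingAssumptions Ω) {xs : ℕ → X}
    (hxs : Tendsto xs atTop (𝓝 x)) {t : ℕ → ℝ} (ht : Tendsto t atTop (𝓝[>] 0)) (d : X)
    {u : ℕ → D.H} {u₀ : D.H} (hu : D.TendstoEnergy θ x u u₀) (hu₀ : u₀ ≠ 0) :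
    Tendsto (fun n => (D.R (xs n + t n • d) (u n) - D.R (xs n) (u n)) / t n) atTop
      (𝓝 (D.Rx x u₀ d)) := by
  have ht0 : Tendsto t atTop (𝓝 0) := ht.mono_right nhdsWithin_le_nhds
  obtain ⟨r, hr, hball⟩ := Metric.mem_nhds_iff.1 h.nhd
  have hend : Tendsto (fun n => xs n + t n • d) atTop (𝓝 x) := by
    simpa using hxs.add (ht0.smul_const d)
  have hz : ∀ n, ∃ z : X, ‖z - xs n‖ ≤ |t n| * ‖d‖ ∧
      (0 < t n → u n ≠ 0 → xs n ∈ Metric.ball x r → xs n + t n • d ∈ Metric.ball x r →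
        D.Rx z (u n) d = (D.R (xs n + t n • d) (u n) - D.R (xs n) (u n)) / t n) := by
    intro n
    by_cases hgood : 0 < t n ∧ u n ≠ 0 ∧ xs n ∈ Metric.ball x r ∧ xs n + t n • d ∈ Metric.ball x r
    · obtain ⟨htn, hun, h1, h2⟩ := hgood
      have hder : ∀ s ∈ Icc 0 (t n), HasDerivAt (fun s : ℝ => D.R (xs n + s • d) (u n))
          (D.Rx (xs n + s • d) (u n) d) s := by
        intro s hs
        have hmem : xs n + s • d ∈ Metric.ball x r := by
          have := (convex_ball x r).add_smul_sub_mem h1 h2 (t := s / t n)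
            ⟨div_nonneg hs.1 htn.le, (div_le_one htn).2 hs.2⟩
          rwa [add_sub_cancel_left, smul_smul, div_mul_cancel₀ _ htn.ne'] at this
        have hR : HasFDerivAt (fun y => D.R y (u n)) (D.Rx (xs n + s • d) (u n)) (xs n + s • d) :=
          (hD.hasFDerivAt_R (h.subset (hball hmem)) hun).differentiableAt.hasFDerivAt
        have hl : HasDerivAt (fun s : ℝ => xs n + s • d) d s := by
          simpa using ((hasDerivAt_id s).smul_const d).const_add (xs n)
        exact hR.comp_hasDerivAt s hl
      obtain ⟨s, hs, hslope⟩ := exists_hasDerivAt_eq_slope _ _ htn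
        (fun s hs => (hder s hs).continuousAt.continuousWithinAt)
        (fun s hs => hder s (Ioo_subset_Icc_self hs))
      refine ⟨xs n + s • d, ?_, fun _ _ _ _ => by simpa using hslope⟩
      rw [add_sub_cancel_left, norm_smul, Real.norm_eq_abs, abs_of_pos hs.1, abs_of_pos htn]
      exact mul_le_mul_of_nonneg_right hs.2.le (norm_nonneg _)
    · refine ⟨xs n, by simp; positivity, fun h1 h2 h3 h4 => (hgood ⟨h1, h2, h3, h4⟩).elim⟩
  choose z hz1 hz2 using hz
  have hzx : Tendsto z atTop (𝓝 x) := by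
    have h1 : Tendsto (fun n => z n - xs n) atTop (𝓝 0) :=
      squeeze_zero_norm hz1 (by simpa using ht0.abs.mul_const ‖d‖)
    simpa using h1.add hxs
  have h1 := ((ContinuousLinearMap.apply ℝ ℝ d).continuous.tendsto _).comp
    (h.tendsto_Rx hD hzx hu hu₀)
  refine h1.congr' ?_
  filter_upwards [ht.eventually self_mem_nhdsWithin, h.eventually_ne_zero hD hu hu₀,
    hxs.eventually (Metric.ball_mem_nhds x hr), hend.eventually (Metric.ball_mem_nhds x hr)]
    with n h1 h2 h3 h4
  exact hz2 n h1 h2 h3 h4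

end LocalAssumptions
end RayleighData

/-! ### Existence of eigenvectors -/

namespace RayleighData

variable {X Y : Type*} [NormedAddCommGroup X] [NormedSpace ℝ X] [AddCommGroup Y] [Module ℝ Y]
variable {D : RayleighData X Y} {Ω : Set X} {x y : X} {V : Set X} {θ : X → ℝ}

theorem G_sub (y : X) (u v : D.H) : D.G y (u - v) = D.G y u - 2 * D.Γ y u v + D.G y v := by
  have h1 : D.G y (-v) = D.G y v := QuadraticMap.map_neg _ _
  rw [sub_eq_add_neg, G_add, h1, map_neg]; ring

namespace LocalAssumptions

variable (h : D.LocalAssumptions Ω x V θ)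
include h

theorem tendsto_B_of_tendsto_Q {xs : ℕ → X} (hV : ∀ n, xs n ∈ V) (hxs : Tendsto xs atTop (𝓝 x))
    {u : ℕ → Y} {u₀ : Y} (hu : Tendsto (fun n => D.Q (xs n) (u n - u₀)) atTop (𝓝 0)) (v : Y) :
    Tendsto (fun n => D.B (xs n) (u n) v) atTop (𝓝 (D.B x u₀ v)) := by
  have h1 := (h.continuity_Q xs (fun n => u n + v) (u₀ + v) hV hxs (by simpa using hu)).1
  have h2 := (h.continuity_Q xs u u₀ hV hxs hu).1
  have h3 := (h.continuity_Q xs (fun _ => v) v hV hxs (by simp)).1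
  simpa only [B_eq] using ((h1.sub h2).sub h3).div_const 2

/-- The form `G x` attains its minimum on the unit vectors orthogonal to given vectors. -/
theorem exists_minimizer (hD : D.StandingAssumptions Ω) (hH : ¬ FiniteDimensional ℝ D.H)
    (n : ℕ) (e : ℕ → D.H) :
    ∃ u : D.H, (D.Q x (u : Y) = 1 ∧ ∀ i < n, D.BH x (e i) u = 0) ∧
      ∀ v : D.H, D.Q x (v : Y) = 1 → (∀ i < n, D.BH x (e i) v = 0) → D.G x u ≤ D.G x v := by
  set S : Set D.H := {v | D.Q x (v : Y) = 1 ∧ ∀ i < n, D.BH x (e i) v = 0} with hS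
  have hpos := h.energy_nonneg h.mem
  have hne : (D.G x '' S).Nonempty := by
    have htop : ¬ FiniteDimensional ℝ (⊤ : Submodule ℝ D.H) := fun hfin =>
      hH (Module.Finite.equiv (Submodule.topEquiv (R := ℝ) (M := D.H)))
    obtain ⟨u, -, hu⟩ := exists_unit_orthogonal (hD.posDef x (h.subset h.mem)) ⊤ (n := n) e
      fun hfin => (htop hfin).elim
    exact ⟨_, u, hu, rfl⟩
  have hbdd : BddBelow (D.G x '' S) := by
    refine ⟨-θ x, ?_⟩
    rintro _ ⟨v, hv, rfl⟩
    have := hpos v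
    rw [energy, hv.1] at this
    linarith
  obtain ⟨g, -, hg, hgS⟩ := exists_seq_tendsto_sInf hne hbdd
  choose v hvS hvg using hgS
  obtain ⟨M, hM⟩ := hg.bddAbove_range
  obtain ⟨u, φ, hφ, hQ, hΓ⟩ := h.compactness (fun _ => x) v (fun _ => h.mem) tendsto_const_nhds
    ⟨Real.sqrt (M + θ x), fun m => Real.sqrt_le_sqrt (by
      rw [hvg, (hvS m).1, mul_one]
      exact add_le_add_left (hM ⟨m, rfl⟩) _)⟩
  have hB := fun w : Y => h.tendsto_B_of_tendsto_Q (xs := fun _ => x)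
    (u := fun m => (v (φ m) : Y)) (fun _ => h.mem) tendsto_const_nhds hQ w
  have hQu : D.Q x (u : Y) = 1 := by
    have h1 := (h.continuity_Q (fun _ => x) (fun m => (v (φ m) : Y)) u (fun _ => h.mem)
      tendsto_const_nhds hQ).1
    exact tendsto_nhds_unique h1 (by simp [(hvS _).1])
  have hSu : u ∈ S := by
    refine ⟨hQu, fun i hi => ?_⟩
    rw [BH_comm]
    refine tendsto_nhds_unique (hB (e i)) ?_
    have : ∀ m, D.B x (v (φ m) : Y) (e i : Y) = 0 := fun m => by
      rw [B_comm]; exact (hvS (φ m)).2 i hi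
    simp [this]
  have hle : D.G x u ≤ sInf (D.G x '' S) := by
    have h1 : Tendsto (fun m => D.energy θ x (v (φ m) - u)) atTop
        (𝓝 (sInf (D.G x '' S) + θ x * 1 - 2 * (D.Γ x u u + θ x * D.BH x u u) +
          D.energy θ x u)) := by
      simp only [energy_sub]
      refine Tendsto.add_const _ (Tendsto.sub ?_ (((hΓ u).add ((hB u).const_mul _)).const_mul 2))
      have h2 : ∀ m, D.energy θ x (v (φ m)) = g (φ m) + θ x * 1 := fun m => by
        rw [energy, hvg, (hvS _).1]
      simp only [h2]
      exact (hg.comp hφ.tendsto_atTop).add_const _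
    have h3 := ge_of_tendsto' h1 fun m => hpos _
    rw [Γ_self, BH_self, energy, hQu] at h3
    linarith
  exact ⟨u, hSu, fun w h1 h2 => hle.trans (csInf_le hbdd ⟨w, ⟨h1, h2⟩, rfl⟩)⟩

end LocalAssumptions

theorem eq_zero_of_forall_quadratic_nonneg {a b : ℝ} (hb : 0 ≤ b)
    (h : ∀ t : ℝ, 0 ≤ 2 * t * a + t ^ 2 * b) : a = 0 := by
  have h1 := h (-a / (b + 1))
  have h2 : 2 * (-a / (b + 1)) * a + (-a / (b + 1)) ^ 2 * b =
      -(a ^ 2 * (b + 2)) / (b + 1) ^ 2 := by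
    field_simp; ring
  rw [h2] at h1
  by_contra ha
  have : 0 < a ^ 2 * (b + 2) / (b + 1) ^ 2 := by positivity
  rw [neg_div] at h1
  linarith

namespace StandingAssumptions

variable (hD : D.StandingAssumptions Ω) (hH : ¬ FiniteDimensional ℝ D.H)
include hD hH

/-- The next eigenvector minimizes `G` among the unit vectors orthogonal to the given ones; the
first-order condition at the minimum is the eigenvalue equation. -/
theorem exists_eigensystem_succ (hy : y ∈ Ω) {n : ℕ} {e : ℕ → D.H} (he : D.IsEigensystem y n e) :
    ∃ e', D.IsEigensystem y (n + 1) e' := by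
  obtain ⟨V, θ, h⟩ := hD.loc y hy
  have hQ := hD.posDef y hy
  obtain ⟨u, ⟨hu1, hue⟩, hmin⟩ := h.exists_minimizer hD hH n e
  set μ := D.G y u with hμ
  have hlow : ∀ w : D.H, (∀ i < n, D.BH y (e i) w = 0) → μ * D.Q y (w : Y) ≤ D.G y w := by
    intro w hw
    rcases eq_or_ne w 0 with rfl | hw0
    · simp
    obtain ⟨a, ha, haw⟩ := exists_smul_unit hQ hw0
    have h1 := hmin _ haw fun i hi => by rw [map_smul, hw i hi, smul_zero]
    rw [Submodule.coe_smul, Q_smul] at haw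
    rw [G_smul] at h1
    have ha2 : 0 < a ^ 2 := by positivity
    refine le_of_mul_le_mul_left ?_ ha2
    calc a ^ 2 * (μ * D.Q y (w : Y)) = μ * (a ^ 2 * D.Q y (w : Y)) := by ring
      _ = μ := by rw [haw, mul_one]
      _ ≤ _ := h1
  have hfirst : ∀ w : D.H, (∀ i < n, D.BH y (e i) w = 0) → D.Γ y u w = μ * D.BH y u w := by
    intro w hw
    refine sub_eq_zero.1 (eq_zero_of_forall_quadratic_nonneg
      (b := D.G y w - μ * D.Q y (w : Y)) (by linarith [hlow w hw]) fun t => ?_)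
    have h1 := hlow (u + t • w) fun i hi => by
      rw [map_add, map_smul, hw i hi, hue i hi, smul_zero, add_zero]
    rw [Submodule.coe_add, Q_add, G_add, Submodule.coe_smul, Q_smul, G_smul, hu1, map_smul,
      map_smul, ← BH_apply, smul_eq_mul, smul_eq_mul] at h1
    linarith
  have hall : ∀ v : D.H, D.Γ y u v = μ * D.BH y u v := by
    intro v
    set s : D.H := ∑ i : Fin n, D.BH y (e i) v • e i with hs
    have h1 := hfirst (v - s) fun i hi => by
      rw [map_sub, BH_comm y (e i) s, hs,
        he.orthonormal.apply_sum (fun i : Fin n => D.BH y (e i) v) ⟨i, hi⟩, sub_self]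
    have h2 : D.Γ y u s = 0 := by
      rw [Γ_comm, hs, he.Γ_sum]
      exact Finset.sum_eq_zero fun i _ => by rw [hue i i.2, mul_zero]
    have h3 : D.BH y u s = 0 := by
      rw [hs, map_sum]
      exact Finset.sum_eq_zero fun i _ => by
        rw [map_smul, BH_comm y u, hue i i.2, smul_zero]
    rwa [map_sub, map_sub, h2, h3, sub_zero, sub_zero] at h1
  have hval : D.eigenvalue (n + 1) y = μ := by
    refine le_antisymm ?_ (le_eigenvalue hD hH hy fun E hE => ?_)
    · simpa [hu1] using he.le_G hD hy hue
    · obtain ⟨w, hwE, hw1, hwe⟩ := exists_unit_orthogonal hQ E (n := n) e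
        (fun _ => by omega)
      exact ⟨w, hwE, hw1, hmin w hw1 hwe⟩
  refine ⟨Function.update e n u, fun i hi j hj => ?_, fun i hi v => ?_⟩
  · rcases eq_or_ne i n with rfl | hin <;> rcases eq_or_ne j i with rfl | hji
    · simp [BH_self, hu1]
    · rw [Function.update_self, Function.update_of_ne hji, if_neg hji.symm, BH_comm]
      exact hue j (by omega)
    · rw [Function.update_of_ne hin, he.orthonormal j (by omega) j (by omega)]
    · rw [Function.update_of_ne hin]
      rcases eq_or_ne j n with rfl | hjn
      · rw [Function.update_self, if_neg hji.symm]
        exact hue i (by omega)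
      · rw [Function.update_of_ne hjn, he.orthonormal i (by omega) j (by omega)]
  · rcases eq_or_ne i n with rfl | hin
    · rw [Function.update_self, hval, hall]
    · rw [Function.update_of_ne hin, he.eigen i (by omega)]

theorem exists_eigensystem (hy : y ∈ Ω) (n : ℕ) : ∃ e, D.IsEigensystem y n e := by
  induction n with
  | zero => exact ⟨fun _ => 0, ⟨fun i hi => by omega, fun i hi => by omega⟩⟩
  | succ n ih =>
    obtain ⟨e, he⟩ := ih
    exact hD.exists_eigensystem_succ hH hy he

/-- Any `n + 1` vectors have a combination whose Rayleigh quotient is at least the eigenvalue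
number `n + 1`: choose it orthogonal to the first `n` eigenvectors. -/
theorem exists_combination_eigenvalue_le (hy : y ∈ Ω) (n : ℕ) (f : ℕ → D.H) :
    ∃ c : Fin (n + 1) → ℝ, ‖c‖ = 1 ∧
      D.eigenvalue (n + 1) y * D.Q y ((∑ i, c i • f i : D.H) : Y) ≤ D.G y (∑ i, c i • f i) := by
  obtain ⟨e, he⟩ := hD.exists_eigensystem hH hy n
  let F : (Fin (n + 1) → ℝ) →ₗ[ℝ] D.H := Fintype.linearCombination ℝ fun i : Fin (n + 1) => f i
  have hF : ∀ c, F c = ∑ i, c i • f i := fun c => Fintype.linearCombination_apply _ _ _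
  obtain ⟨c, -, hc, h⟩ := (⊤ : Submodule ℝ (Fin (n + 1) → ℝ)).exists_ne_zero_forall_apply_eq_zero
    (fun i : Fin n => (D.BH y (e i)).comp F) (fun _ => by simp)
  have hn : 0 < ‖c‖ := norm_pos_iff.2 hc
  refine ⟨‖c‖⁻¹ • c, by simp [norm_smul, hn.ne'], ?_⟩
  rw [← hF]
  refine he.le_G hD hy fun i hi => ?_
  have := h ⟨i, hi⟩
  simp only [LinearMap.comp_apply] at this
  rw [map_smul, map_smul, this, smul_zero]

end StandingAssumptions

/-! ### Convergence of eigenvalues and eigenvectors -/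

namespace LocalAssumptions

variable (h : D.LocalAssumptions Ω x V θ) (hD : D.StandingAssumptions Ω)
include h hD

/-- Eigenvectors at parameters tending to `x` converge along a subsequence, for the norm
`N(x, ·)`, when the eigenvalues converge. -/
theorem exists_eigenvector_limit {xs : ℕ → X} (hV : ∀ n, xs n ∈ V)
    (hxs : Tendsto xs atTop (𝓝 x)) {μ : ℕ → ℝ} {μ₀ : ℝ} (hμ : Tendsto μ atTop (𝓝 μ₀))
    {u : ℕ → D.H} (hu1 : ∀ n, D.Q (xs n) (u n : Y) = 1)
    (hu : ∀ n v, D.Γ (xs n) (u n) v = μ n * D.BH (xs n) (u n) v) :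
    ∃ (u₀ : D.H) (φ : ℕ → ℕ), StrictMono φ ∧ D.TendstoEnergy θ x (fun n => u (φ n)) u₀ ∧
      D.Q x (u₀ : Y) = 1 ∧ ∀ v, D.Γ x u₀ v = μ₀ * D.BH x u₀ v := by
  obtain ⟨M, hM⟩ := h.θ_bdd
  obtain ⟨M', hM'⟩ := hμ.bddAbove_range
  have hG : ∀ n, D.G (xs n) (u n) = μ n := fun n => by
    rw [← Γ_self, hu, BH_self, hu1, mul_one]
  obtain ⟨u₀, φ, hφ, hQ, hΓ⟩ := h.compactness xs u hV hxs
    ⟨Real.sqrt (M' + M), fun n => Real.sqrt_le_sqrt (by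
      rw [hG, hu1, mul_one]
      exact add_le_add (hM' ⟨n, rfl⟩) (hM _ (hV n)))⟩
  have hxφ : Tendsto (fun n => xs (φ n)) atTop (𝓝 x) := hxs.comp hφ.tendsto_atTop
  have hμφ : Tendsto (fun n => μ (φ n)) atTop (𝓝 μ₀) := hμ.comp hφ.tendsto_atTop
  have hB := fun w : Y => h.tendsto_B_of_tendsto_Q (xs := fun n => xs (φ n))
    (u := fun m => (u (φ m) : Y)) (fun _ => hV _) hxφ hQ w
  have hQu : D.Q x (u₀ : Y) = 1 := by
    have h1 := (h.continuity_Q (fun n => xs (φ n)) (fun m => (u (φ m) : Y)) u₀ (fun _ => hV _)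
      hxφ hQ).1
    exact tendsto_nhds_unique h1 (by simp [hu1])
  have heq : ∀ v, D.Γ x u₀ v = μ₀ * D.BH x u₀ v := fun v => by
    refine tendsto_nhds_unique (hΓ v) ?_
    simp only [hu]
    exact hμφ.mul (hB v)
  have hGu : D.G x u₀ = μ₀ := by rw [← Γ_self, heq, BH_self, hQu, mul_one]
  refine ⟨u₀, φ, hφ, ?_, hQu, heq⟩
  obtain ⟨K, hK, hE⟩ := h.exists_energy_le
  have hlim : Tendsto (fun n => D.energy θ (xs (φ n)) (u (φ n) - u₀)) atTop (𝓝 0) := by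
    have h1 := (h.tendsto_forms hD hxφ (tendstoEnergy_const u₀)).2.1
    have h2 : Tendsto (fun n => θ (xs (φ n)) * D.Q (xs (φ n)) ((u (φ n) : Y) - (u₀ : Y))) atTop
        (𝓝 0) := by
      refine squeeze_zero (fun n => mul_nonneg (h.θ_pos _ (hV _)).le
        ((hD.posDef _ (h.subset (hV _))).nonneg _))
        (fun n => mul_le_mul_of_nonneg_right (hM _ (hV _))
          ((hD.posDef _ (h.subset (hV _))).nonneg _)) ?_
      simpa using hQ.const_mul M
    have h3 := ((hμφ.sub ((hΓ u₀).const_mul 2)).add h1).add h2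
    rw [Γ_self, hGu] at h3
    have h4 : μ₀ - 2 * μ₀ + μ₀ + 0 = 0 := by ring
    rw [h4] at h3
    refine h3.congr fun n => ?_
    rw [energy, G_sub, hG, Submodule.coe_sub]
  refine squeeze_zero (fun n => h.energy_nonneg h.mem _) (fun n => (hE _ (hV (φ n)) _).2) ?_
  simpa using hlim.const_mul K

variable (hH : ¬ FiniteDimensional ℝ D.H)
include hH

/-- Upper semicontinuity of the eigenvalues, with the span of eigenvectors at `x` as trial space. -/
theorem eventually_eigenvalue_lt (n : ℕ) {a : ℝ} (ha : D.eigenvalue (n + 1) x < a) :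
    ∀ᶠ y in 𝓝 x, D.eigenvalue (n + 1) y < a := by
  have hx := h.subset h.mem
  by_contra hcon
  obtain ⟨xs, hxs, hP⟩ := exists_seq_forall_of_frequently
    ((not_eventually.1 hcon).and_eventually h.nhd)
  obtain ⟨e, he⟩ := hD.exists_eigensystem hH hx (n + 1)
  choose c hc hle using fun m =>
    hD.exists_combination_eigenvalue_le hH (h.subset (hP m).2) n e
  obtain ⟨c₀, hc₀, φ, hφ, hcφ⟩ := (isCompact_sphere (0 : Fin (n + 1) → ℝ) 1).tendsto_subseq
    (x := c) fun m => by simpa using hc m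
  have hxφ : Tendsto (fun m => xs (φ m)) atTop (𝓝 x) := hxs.comp hφ.tendsto_atTop
  have hw : D.TendstoEnergy θ x (fun m => ∑ i, c (φ m) i • e i) (∑ i, c₀ i • e i) :=
    h.tendstoEnergy_sum (u := fun _ i => e i) (fun i => (tendsto_pi_nhds.1 hcφ) i)
      fun i _ => tendstoEnergy_const _
  obtain ⟨⟨h1, -⟩, h2, -⟩ := h.tendsto_forms hD hxφ hw
  have h3 : a * D.Q x ((∑ i, c₀ i • e i : D.H) : Y) ≤ D.G x (∑ i, c₀ i • e i) := by
    refine le_of_tendsto_of_tendsto' (h1.const_mul a) h2 fun m => ?_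
    refine le_trans (mul_le_mul_of_nonneg_right (not_lt.1 (hP (φ m)).1) ?_) (hle (φ m))
    exact (hD.posDef _ (h.subset (hP (φ m)).2)).nonneg _
  have h4 := he.G_sum_le hD hx c₀
  have h5 : 0 < D.Q x ((∑ i, c₀ i • e i : D.H) : Y) := by
    refine Q_pos (hD.posDef x hx) fun h0 => ?_
    have : c₀ = 0 := funext fun i => by
      have := he.orthonormal.apply_sum c₀ i
      rw [h0] at this
      simpa using this.symm
    simp [this] at hc₀
  nlinarith

/-- Extraction of a common subsequence along which finitely many eigenvalues and eigenvectors
converge. That the limits `l i` are the eigenvalues at `x` is shown in `exists_eigensystem_limit`. -/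
theorem exists_eigensystem_subseq {xs : ℕ → X} (hV : ∀ m, xs m ∈ V)
    (hxs : Tendsto xs atTop (𝓝 x)) {n : ℕ} {e : ℕ → ℕ → D.H}
    (he : ∀ m, D.IsEigensystem (xs m) n (e m)) :
    ∃ (φ : ℕ → ℕ) (e₀ : ℕ → D.H) (l : ℕ → ℝ), StrictMono φ ∧ ∀ i < n,
      D.TendstoEnergy θ x (fun m => e (φ m) i) (e₀ i) ∧
      Tendsto (fun m => D.eigenvalue (i + 1) (xs (φ m))) atTop (𝓝 (l i)) ∧
      ∀ v, D.Γ x (e₀ i) v = l i * D.BH x (e₀ i) v := by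
  induction n with
  | zero => exact ⟨id, fun _ => 0, fun _ => 0, strictMono_id, fun i hi => by omega⟩
  | succ n ih =>
    obtain ⟨φ, e₀, l, hφ, hlim⟩ := ih fun m => (he m).mono n.le_succ
    obtain ⟨M, hM⟩ := h.θ_bdd
    have hxφ : Tendsto (fun m => xs (φ m)) atTop (𝓝 x) := hxs.comp hφ.tendsto_atTop
    have hb : ∀ᶠ m in atTop, D.eigenvalue (n + 1) (xs (φ m)) ∈
        Icc (-M) (D.eigenvalue (n + 1) x + 1) := by
      filter_upwards [hxφ.eventually (h.eventually_eigenvalue_lt hD hH n (lt_add_one _))] with m hm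
      refine ⟨?_, hm.le⟩
      have h1 := h.energy_nonneg (hV (φ m)) (e (φ m) n)
      rw [energy, (he (φ m)).G_eq n.lt_succ_self, (he (φ m)).Q_eq n.lt_succ_self] at h1
      linarith [hM _ (hV (φ m))]
    obtain ⟨l', -, ψ, hψ, hl'⟩ := isCompact_Icc.tendsto_subseq' hb.frequently
    obtain ⟨u₀, χ, hχ, hu₀, -, hu⟩ := h.exists_eigenvector_limit hD
      (xs := fun m => xs (φ (ψ m))) (fun _ => hV _) (hxφ.comp hψ.tendsto_atTop) hl'
      (u := fun m => e (φ (ψ m)) n) (fun m => (he _).Q_eq n.lt_succ_self)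
      (fun m v => (he _).eigen n n.lt_succ_self v)
    refine ⟨φ ∘ ψ ∘ χ, Function.update e₀ n u₀, Function.update l n l', hφ.comp (hψ.comp hχ),
      fun i hi => ?_⟩
    rcases eq_or_ne i n with rfl | hin
    · simp only [Function.update_self]
      exact ⟨hu₀, hl'.comp hχ.tendsto_atTop, hu⟩
    · simp only [Function.update_of_ne hin]
      obtain ⟨h1, h2, h3⟩ := hlim i (by omega)
      have hψχ := (hψ.comp hχ).tendsto_atTop
      exact ⟨h1.comp hψχ, h2.comp hψχ, h3⟩

/-- Eigensystems at parameters tending to `x` converge along a subsequence to an eigensystem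
at `x`. -/
theorem exists_eigensystem_limit {xs : ℕ → X} (hV : ∀ m, xs m ∈ V)
    (hxs : Tendsto xs atTop (𝓝 x)) {n : ℕ} {e : ℕ → ℕ → D.H}
    (he : ∀ m, D.IsEigensystem (xs m) n (e m)) :
    ∃ (φ : ℕ → ℕ) (e₀ : ℕ → D.H), StrictMono φ ∧ D.IsEigensystem x n e₀ ∧ ∀ i < n,
      D.TendstoEnergy θ x (fun m => e (φ m) i) (e₀ i) ∧
      Tendsto (fun m => D.eigenvalue (i + 1) (xs (φ m))) atTop (𝓝 (D.eigenvalue (i + 1) x)) := by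
  obtain ⟨φ, e₀, l, hφ, hlim⟩ := h.exists_eigensystem_subseq hD hH hV hxs he
  have hx := h.subset h.mem
  have hxφ : Tendsto (fun m => xs (φ m)) atTop (𝓝 x) := hxs.comp hφ.tendsto_atTop
  have hon : D.IsOrthonormal x n e₀ := fun i hi j hj => by
    refine tendsto_nhds_unique (h.tendsto_BH hD hxφ (hlim i hi).1 (hlim j hj).1) ?_
    simp only [(he _).orthonormal i hi j hj]
    exact tendsto_const_nhds
  have hGl : ∀ i < n, D.G x (e₀ i) = l i := fun i hi => by
    rw [← Γ_self, (hlim i hi).2.2, hon i hi i hi, if_pos rfl, mul_one]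
  have hl : ∀ i < n, l i = D.eigenvalue (i + 1) x := by
    intro i hi
    refine le_antisymm ?_ ?_
    · refine le_of_forall_gt_imp_ge_of_dense fun a ha => ?_
      exact le_of_tendsto (hlim i hi).2.1
        ((hxφ.eventually (h.eventually_eigenvalue_lt hD hH i ha)).mono fun m hm => hm.le)
    · refine eigenvalue_le_of_diagonal (f := e₀) hD hx
        (fun j hj k hk => hon j (by omega) k (by omega)) (fun j hj k hk hjk => ?_)
        (fun j hj => ?_)
      · rw [(hlim j (by omega)).2.2, hon j (by omega) k (by omega), if_neg hjk, mul_zero]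
      · rw [hGl j (by omega)]
        exact le_of_tendsto_of_tendsto' (hlim j (by omega)).2.1 (hlim i hi).2.1 fun m =>
          (he (φ m)).eigenvalue_mono hD (h.subset (hV _)) (by omega) hi
  refine ⟨φ, e₀, hφ, ⟨hon, fun i hi v => ?_⟩, fun i hi => ⟨(hlim i hi).1, ?_⟩⟩
  · rw [(hlim i hi).2.2, hl i hi]
  · rw [← hl i hi]; exact (hlim i hi).2.1

theorem continuousAt_eigenvalue (n : ℕ) : ContinuousAt (D.eigenvalue (n + 1)) x := by
  refine tendsto_of_subseq_tendsto fun xs hxs => ?_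
  obtain ⟨N, hN⟩ := eventually_atTop.1 (hxs.eventually h.nhd)
  have hV : ∀ m, xs (m + N) ∈ V := fun m => hN _ (by omega)
  choose e he using fun m => hD.exists_eigensystem hH (h.subset (hV m)) (n + 1)
  obtain ⟨φ, _, -, -, hlim⟩ := h.exists_eigensystem_limit hD hH hV
    (hxs.comp (tendsto_add_atTop_nat N)) he
  exact ⟨fun m => φ m + N, (hlim n n.lt_succ_self).2⟩

end LocalAssumptions
end RayleighData

/-! ### Difference quotients of the eigenvalues -/

theorem tendsto_add_smul_nhdsGT {X : Type*} [NormedAddCommGroup X] [NormedSpace ℝ X] (x d : X) :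
    Tendsto (fun t : ℝ => x + t • d) (𝓝[>] 0) (𝓝 x) := by
  have h0 : Tendsto (fun t : ℝ => t) (𝓝[>] (0 : ℝ)) (𝓝 0) := nhdsWithin_le_nhds
  simpa using (h0.smul_const d).const_add x

namespace RayleighData

variable {X Y : Type*} [NormedAddCommGroup X] [NormedSpace ℝ X] [AddCommGroup Y] [Module ℝ Y]
variable {D : RayleighData X Y} {Ω : Set X} {x y : X} {V : Set X} {θ : X → ℝ}

theorem BH_eq_zero_of_mem_eigenspace {k n : ℕ} {e : ℕ → D.H} (he : D.IsEigensystem y n e)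
    {u : D.H} (hu : u ∈ D.eigenspace k y) {i : ℕ} (hi : i < n)
    (hne : D.eigenvalue (i + 1) y ≠ D.eigenvalue k y) : D.BH y (e i) u = 0 := by
  have h1 := mem_eigenspace_iff.1 hu (e i)
  rw [Γ_comm, he.eigen i hi, BH_comm y u] at h1
  have h2 : (D.eigenvalue (i + 1) y - D.eigenvalue k y) * D.BH y (e i) u = 0 := by
    rw [sub_mul, h1, sub_self]
  exact (mul_eq_zero.1 h2).resolve_left (sub_ne_zero.2 hne)

/-- Across a gap after the eigenvalue number `n + 1`, its eigenvectors are combinations of the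
first `n + 1` vectors of any eigensystem. -/
theorem IsEigensystem.sum_eq_of_mem_eigenspace (hD : D.StandingAssumptions Ω) (hy : y ∈ Ω)
    {n : ℕ} {e : ℕ → D.H} (he : D.IsEigensystem y (n + 1) e)
    (hgap : D.eigenvalue (n + 1) y < D.eigenvalue (n + 2) y) {u : D.H}
    (hu : u ∈ D.eigenspace (n + 1) y) :
    ∑ i : Fin (n + 1), D.BH y u (e i) • e i = u := by
  set s : D.H := ∑ i : Fin (n + 1), D.BH y u (e i) • e i with hs
  set r := u - s with hr
  have hre : ∀ i < n + 1, D.BH y (e i) r = 0 := fun i hi => by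
    rw [hr, map_sub, BH_comm y (e i) s, hs,
      he.orthonormal.apply_sum (fun i : Fin (n + 1) => D.BH y u (e i)) ⟨i, hi⟩, BH_comm, sub_self]
  have hBs : D.BH y s r = 0 := by
    rw [BH_comm, hs, map_sum]
    exact Finset.sum_eq_zero fun i _ => by rw [map_smul, BH_comm y r, hre i i.2, smul_zero]
  have hΓs : D.Γ y s r = 0 := by
    rw [hs, he.Γ_sum]
    exact Finset.sum_eq_zero fun i _ => by rw [hre i i.2, mul_zero]
  have hG : D.G y r = D.eigenvalue (n + 1) y * D.Q y (r : Y) := by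
    have h1 := mem_eigenspace_iff.1 hu r
    have h2 : u = r + s := by rw [hr, sub_add_cancel]
    nth_rewrite 1 2 [h2] at h1
    rwa [map_add, map_add, LinearMap.add_apply, LinearMap.add_apply, hBs, hΓs, add_zero,
      add_zero, Γ_self, BH_self] at h1
  have h3 := he.le_G hD hy hre
  by_contra hne
  have h4 := Q_pos (hD.posDef y hy) (u := r) (sub_ne_zero.2 fun h0 => hne h0.symm)
  nlinarith

theorem le_R_of_mul_le (hQ : (D.Q y).PosDef) {v : D.H} (hv : v ≠ 0) {a : ℝ}
    (h : a * D.Q y (v : Y) ≤ D.G y v) : a ≤ D.R y v :=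
  (le_div_iff₀ (Q_pos hQ hv)).2 h

theorem R_le_of_le_mul (hQ : (D.Q y).PosDef) {v : D.H} (hv : v ≠ 0) {a : ℝ}
    (h : D.G y v ≤ a * D.Q y (v : Y)) : D.R y v ≤ a :=
  (div_le_iff₀ (Q_pos hQ hv)).2 h

namespace LocalAssumptions

variable (h : D.LocalAssumptions Ω x V θ) (hD : D.StandingAssumptions Ω)
  (hH : ¬ FiniteDimensional ℝ D.H)
include h hD hH

/-- Near `x` the difference quotients of an eigenvalue are almost bounded by the derivative of the
Rayleigh quotient at some unit eigenvector of `x`: the span of the first eigenvectors at the base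
point of the quotient serves as trial space for the other point. -/
theorem eventually_quotient_le (m : ℕ) (d : X) {ε : ℝ} (hε : 0 < ε) :
    ∀ᶠ p : X × ℝ in 𝓝 x ×ˢ 𝓝[>] (0 : ℝ), ∃ u ∈ D.unitEigenvectors (m + 1) x,
      (D.eigenvalue (m + 1) (p.1 + p.2 • d) - D.eigenvalue (m + 1) p.1) / p.2 ≤
        D.Rx x u d + ε := by
  have hx := h.subset h.mem
  have hpos := hD.posDef
  have hfst : Tendsto (fun p : X × ℝ => p.1) (𝓝 x ×ˢ 𝓝[>] (0 : ℝ)) (𝓝 x) := tendsto_fst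
  have hsnd : Tendsto (fun p : X × ℝ => p.2) (𝓝 x ×ˢ 𝓝[>] (0 : ℝ)) (𝓝[>] 0) := tendsto_snd
  have hend : Tendsto (fun p : X × ℝ => p.1 + p.2 • d) (𝓝 x ×ˢ 𝓝[>] (0 : ℝ)) (𝓝 x) := by
    simpa using hfst.add ((hsnd.mono_right nhdsWithin_le_nhds).smul_const d)
  by_contra hcon
  obtain ⟨p, hp, hP⟩ := exists_seq_forall_of_frequently
    ((not_eventually.1 hcon).and_eventually ((hfst.eventually h.nhd).and
      ((hend.eventually h.nhd).and (hsnd.eventually self_mem_nhdsWithin))))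
  have hV1 : ∀ n, (p n).1 ∈ V := fun n => (hP n).2.1
  have hV2 : ∀ n, (p n).1 + (p n).2 • d ∈ V := fun n => (hP n).2.2.1
  have ht : ∀ n, 0 < (p n).2 := fun n => (hP n).2.2.2
  choose e he using fun n => hD.exists_eigensystem hH (h.subset (hV1 n)) (m + 1)
  obtain ⟨φ, e₀, hφ, he₀, hlim⟩ := h.exists_eigensystem_limit hD hH hV1 (hfst.comp hp) he
  choose c hc hle using fun n =>
    hD.exists_combination_eigenvalue_le hH (h.subset (hV2 n)) m (e n)
  obtain ⟨c₀, hc₀, ψ, hψ, hcψ⟩ := (isCompact_sphere (0 : Fin (m + 1) → ℝ) 1).tendsto_subseq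
    (x := fun n => c (φ n)) fun n => by simpa using hc (φ n)
  have hχ : Tendsto (fun n => φ (ψ n)) atTop atTop := hφ.tendsto_atTop.comp hψ.tendsto_atTop
  set w : ℕ → D.H := fun n => ∑ i, c (φ (ψ n)) i • e (φ (ψ n)) i with hw
  set w₀ : D.H := ∑ i, c₀ i • e₀ i with hw₀
  have hww : D.TendstoEnergy θ x w w₀ :=
    h.tendstoEnergy_sum (u := fun n i => e (φ (ψ n)) i)
      (fun i => (tendsto_pi_nhds.1 hcψ) i) fun i hi => (hlim i hi).1.comp hψ.tendsto_atTop
  have hw₀ne : w₀ ≠ 0 := fun h0 => by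
    have : c₀ = 0 := funext fun i => by
      have := he₀.orthonormal.apply_sum c₀ i
      rw [← hw₀, h0] at this
      simpa using this.symm
    simp [this] at hc₀
  have hp1 := (hfst.comp hp).comp hχ
  have hp2 := (hend.comp hp).comp hχ
  have hpt := (hsnd.comp hp).comp hχ
  obtain ⟨⟨h1, -⟩, h2, -⟩ := h.tendsto_forms hD hp2 hww
  have hmem : w₀ ∈ D.eigenspace (m + 1) x := by
    refine he₀.sum_mem_eigenspace hD hx c₀ ?_
    exact le_of_tendsto_of_tendsto'
      (((h.continuousAt_eigenvalue hD hH m).tendsto.comp hp2).mul h1) h2 fun n => hle _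
  obtain ⟨a, ha, hau⟩ := exists_smul_unit (hpos x hx) hw₀ne
  have hunit : a • w₀ ∈ D.unitEigenvectors (m + 1) x := by
    refine ⟨mem_eigenspace_iff.2 fun v => ?_, hau⟩
    rw [map_smul, map_smul, LinearMap.smul_apply, LinearMap.smul_apply,
      mem_eigenspace_iff.1 hmem, smul_eq_mul, smul_eq_mul]
    ring
  have hq := h.tendsto_quotient_R hD hp1 hpt d hww hw₀ne
  have hcontra : D.Rx x w₀ d + ε ≤ D.Rx x w₀ d := by
    refine ge_of_tendsto hq ?_
    filter_upwards [h.eventually_ne_zero hD hww hw₀ne] with n hn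
    have h3 := (hP (φ (ψ n))).1
    push Not at h3
    have h4 := h3 _ hunit
    rw [Rx_smul x ha] at h4
    refine h4.le.trans ?_
    have h5 := le_R_of_mul_le (hpos _ (h.subset (hV2 (φ (ψ n))))) hn (hle _)
    have h6 := R_le_of_le_mul (hpos _ (h.subset (hV1 (φ (ψ n))))) hn
      ((he (φ (ψ n))).G_sum_le hD (h.subset (hV1 _)) _)
    exact div_le_div_of_nonneg_right (sub_le_sub h5 h6) (ht _).le
  linarith

/-- Near `x` the difference quotients of an eigenvalue are almost at least the derivative of the
Rayleigh quotient at some unit eigenvector of `x`. -/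
theorem eventually_le_quotient (m : ℕ) (d : X) {ε : ℝ} (hε : 0 < ε) :
    ∀ᶠ p : X × ℝ in 𝓝 x ×ˢ 𝓝[>] (0 : ℝ), ∃ u ∈ D.unitEigenvectors (m + 1) x,
      D.Rx x u d - ε ≤
        (D.eigenvalue (m + 1) (p.1 + p.2 • d) - D.eigenvalue (m + 1) p.1) / p.2 := by
  -- Exchange the two points of the difference quotient and reverse the direction.
  have hfst : Tendsto (fun p : X × ℝ => p.1) (𝓝 x ×ˢ 𝓝[>] (0 : ℝ)) (𝓝 x) := tendsto_fst
  have hsnd : Tendsto (fun p : X × ℝ => p.2) (𝓝 x ×ˢ 𝓝[>] (0 : ℝ)) (𝓝[>] 0) := tendsto_snd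
  have hend : Tendsto (fun p : X × ℝ => p.1 + p.2 • d) (𝓝 x ×ˢ 𝓝[>] (0 : ℝ)) (𝓝 x) := by
    simpa using hfst.add ((hsnd.mono_right nhdsWithin_le_nhds).smul_const d)
  filter_upwards [(hend.prodMk hsnd).eventually (h.eventually_quotient_le hD hH m (-d) hε)]
    with p hp
  obtain ⟨u, hu, hle⟩ := hp
  refine ⟨u, hu, ?_⟩
  simp only [smul_neg, add_neg_cancel_right, map_neg] at hle
  have h1 : (D.eigenvalue (m + 1) (p.1 + p.2 • d) - D.eigenvalue (m + 1) p.1) / p.2 =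
      -((D.eigenvalue (m + 1) p.1 - D.eigenvalue (m + 1) (p.1 + p.2 • d)) / p.2) := by
    rw [← neg_div, neg_sub]
  rw [h1]
  linarith

/-- At a gap above the eigenvalue, every unit eigenvector gives a lower bound for the right
difference quotients at `x`. The trial vector is taken in the span of the first eigenvectors at
`x + t d`, with the same components on the eigenvectors at `x` as the given eigenvector. -/
theorem eventually_le_quotient_of_lt {m : ℕ}
    (hgap : D.eigenvalue (m + 1) x < D.eigenvalue (m + 2) x) {u : D.H}
    (hu : u ∈ D.unitEigenvectors (m + 1) x) (d : X) {ε : ℝ} (hε : 0 < ε) :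
    ∀ᶠ t : ℝ in 𝓝[>] 0, D.Rx x u d - ε ≤
      (D.eigenvalue (m + 1) (x + t • d) - D.eigenvalue (m + 1) x) / t := by
  have hx := h.subset h.mem
  have hend := tendsto_add_smul_nhdsGT x d
  by_contra hcon
  obtain ⟨t, ht, hP⟩ := exists_seq_forall_of_frequently
    ((not_eventually.1 hcon).and_eventually ((hend.eventually h.nhd).and self_mem_nhdsWithin))
  have hV : ∀ n, x + t n • d ∈ V := fun n => (hP n).2.1
  have htpos : ∀ n, 0 < t n := fun n => (hP n).2.2
  choose e he using fun n => hD.exists_eigensystem hH (h.subset (hV n)) (m + 1)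
  obtain ⟨φ, e₀, hφ, he₀, hlim⟩ := h.exists_eigensystem_limit hD hH hV (hend.comp ht) he
  obtain ⟨c, hc, hsol⟩ := Matrix.exists_tendsto_mulVec_eq
    (M := fun n => Matrix.of fun i j : Fin (m + 1) => D.BH x (e (φ n) j) (e₀ i))
    (fun i j => by
      have h1 := h.tendsto_BH hD (tendsto_const_nhds (x := x)) (hlim j j.2).1
        (tendstoEnergy_const (e₀ i))
      rw [he₀.orthonormal j j.2 i i.2] at h1
      simpa [Matrix.one_apply, Fin.ext_iff, eq_comm] using h1)
    (b := fun _ i => D.BH x u (e₀ i)) (fun i => tendsto_const_nhds)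
  set v : ℕ → D.H := fun n => ∑ j, c n j • e (φ n) j with hv
  have hvu : D.TendstoEnergy θ x v u := by
    have := h.tendstoEnergy_sum (u := fun n i => e (φ n) i) hc fun i hi => (hlim i hi).1
    rwa [he₀.sum_eq_of_mem_eigenspace hD hx hgap hu.1] at this
  have hu0 : u ≠ 0 := by
    rintro rfl
    simpa using hu.2
  -- `p` is the number of eigenvalues below the eigenvalue number `m + 1`.
  have hex : ∃ p, D.eigenvalue (p + 1) x = D.eigenvalue (m + 1) x := ⟨m, rfl⟩
  classical
  set p := Nat.find hex with hp
  have hpm : p ≤ m := Nat.find_min' hex rfl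
  have hpe : D.eigenvalue (p + 1) x = D.eigenvalue (m + 1) x := Nat.find_spec hex
  have hq := h.tendsto_quotient_R hD (tendsto_const_nhds (x := x)) (ht.comp hφ.tendsto_atTop) d
    hvu hu0
  have hcontra : D.Rx x u d ≤ D.Rx x u d - ε := by
    refine le_of_tendsto hq ?_
    filter_upwards [h.eventually_ne_zero hD hvu hu0, hsol] with n hn hsoln
    refine le_trans ?_ (not_le.1 (hP (φ n)).1).le
    have h5 : D.R (x + t (φ n) • d) (v n) ≤ D.eigenvalue (m + 1) (x + t (φ n) • d) :=
      R_le_of_le_mul (hD.posDef _ (h.subset (hV _))) hn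
        ((he (φ n)).G_sum_le hD (h.subset (hV _)) _)
    have h6 : D.eigenvalue (m + 1) x ≤ D.R x (v n) := by
      refine le_R_of_mul_le (hD.posDef x hx) hn ?_
      rw [← hpe]
      refine (he₀.mono (m := p) (by omega)).le_G hD hx fun i hi => ?_
      have h7 := hsoln ⟨i, by omega⟩
      have h8 : D.BH x (v n) (e₀ i) = D.BH x u (e₀ i) := by
        rw [← h7, hv]
        simp only [map_sum, map_smul, LinearMap.sum_apply, LinearMap.smul_apply, smul_eq_mul,
          Matrix.of_apply]
        exact Finset.sum_congr rfl fun j _ => mul_comm _ _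
      rw [BH_comm, h8, BH_comm]
      exact BH_eq_zero_of_mem_eigenspace he₀ hu.1 (by omega) (Nat.find_min hex hi)
    exact div_le_div_of_nonneg_right (sub_le_sub h5 h6) (htpos _).le
  linarith

/-- At a gap below the eigenvalue, every unit eigenvector gives an upper bound for the right
difference quotients at `x`. The trial vector is the given eigenvector, corrected by eigenvectors
at `x` for smaller eigenvalues to be orthogonal to the first eigenvectors at `x + t d`. -/
theorem eventually_quotient_le_of_lt {m : ℕ}
    (hgap : ∀ i < m, D.eigenvalue (i + 1) x < D.eigenvalue (m + 1) x) {u : D.H}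
    (hu : u ∈ D.unitEigenvectors (m + 1) x) (d : X) {ε : ℝ} (hε : 0 < ε) :
    ∀ᶠ t : ℝ in 𝓝[>] 0, (D.eigenvalue (m + 1) (x + t • d) - D.eigenvalue (m + 1) x) / t ≤
      D.Rx x u d + ε := by
  have hx := h.subset h.mem
  have hend := tendsto_add_smul_nhdsGT x d
  by_contra hcon
  obtain ⟨t, ht, hP⟩ := exists_seq_forall_of_frequently
    ((not_eventually.1 hcon).and_eventually ((hend.eventually h.nhd).and self_mem_nhdsWithin))
  have hV : ∀ n, x + t n • d ∈ V := fun n => (hP n).2.1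
  have htpos : ∀ n, 0 < t n := fun n => (hP n).2.2
  choose e he using fun n => hD.exists_eigensystem hH (h.subset (hV n)) m
  obtain ⟨φ, e₀, hφ, he₀, hlim⟩ := h.exists_eigensystem_limit hD hH hV (hend.comp ht) he
  have hxφ := (hend.comp ht).comp hφ.tendsto_atTop
  have hue : ∀ i < m, D.BH x (e₀ i) u = 0 := fun i hi =>
    BH_eq_zero_of_mem_eigenspace he₀ hu.1 hi (hgap i hi).ne
  obtain ⟨c, hc, hsol⟩ := Matrix.exists_tendsto_mulVec_eq
    (M := fun n => Matrix.of fun i j : Fin m => D.BH (x + t (φ n) • d) (e₀ j) (e (φ n) i))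
    (fun i j => by
      have h1 := h.tendsto_BH hD hxφ (tendstoEnergy_const (e₀ j)) (hlim i i.2).1
      rw [he₀.orthonormal j j.2 i i.2] at h1
      simpa [Matrix.one_apply, Fin.ext_iff, eq_comm] using h1)
    (b := fun n i => -D.BH (x + t (φ n) • d) u (e (φ n) i)) (b₀ := fun _ => 0) (fun i => by
      have h1 := (h.tendsto_BH hD hxφ (tendstoEnergy_const u) (hlim i i.2).1).neg
      rwa [BH_comm x u, hue i i.2, neg_zero] at h1)
  set v : ℕ → D.H := fun n => u + ∑ j, c n j • e₀ j with hv
  have hvu : D.TendstoEnergy θ x v u := by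
    have := h.tendstoEnergy_add (tendstoEnergy_const u)
      (h.tendstoEnergy_sum (u := fun _ i => e₀ i) hc fun i hi => tendstoEnergy_const (e₀ i))
    simpa using this
  have hu0 : u ≠ 0 := by
    rintro rfl
    simpa using hu.2
  have hq := h.tendsto_quotient_R hD (tendsto_const_nhds (x := x)) (ht.comp hφ.tendsto_atTop) d
    hvu hu0
  have hcontra : D.Rx x u d + ε ≤ D.Rx x u d := by
    refine ge_of_tendsto hq ?_
    filter_upwards [h.eventually_ne_zero hD hvu hu0, hsol] with n hn hsoln
    refine (not_le.1 (hP (φ n)).1).le.trans ?_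
    have h5 : D.eigenvalue (m + 1) (x + t (φ n) • d) ≤ D.R (x + t (φ n) • d) (v n) := by
      refine le_R_of_mul_le (hD.posDef _ (h.subset (hV _))) hn ?_
      refine (he (φ n)).le_G hD (h.subset (hV _)) fun i hi => ?_
      have h7 := hsoln ⟨i, hi⟩
      rw [BH_comm, hv, map_add, LinearMap.add_apply]
      simp only [map_sum, map_smul, LinearMap.sum_apply, LinearMap.smul_apply, smul_eq_mul]
      simp only [Matrix.of_apply] at h7
      rw [← neg_eq_iff_add_eq_zero, ← h7]
      exact Finset.sum_congr rfl fun j _ => mul_comm _ _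
    have h6 : D.R x (v n) ≤ D.eigenvalue (m + 1) x := by
      refine R_le_of_le_mul (hD.posDef x hx) hn ?_
      have hB : D.B x (u : Y) ((∑ j, c n j • e₀ j : D.H) : Y) = 0 := by
        rw [← BH_apply, map_sum]
        exact Finset.sum_eq_zero fun i _ => by rw [map_smul, BH_comm, hue i i.2, smul_zero]
      have hΓ : D.Γ x u (∑ j, c n j • e₀ j) = 0 := by
        rw [mem_eigenspace_iff.1 hu.1, BH_apply, hB, mul_zero]
      have hG : D.G x (∑ j, c n j • e₀ j) ≤
          D.eigenvalue (m + 1) x * D.Q x ((∑ j, c n j • e₀ j : D.H) : Y) := by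
        rw [he₀.G_sum, he₀.orthonormal.Q_sum, Finset.mul_sum]
        refine Finset.sum_le_sum fun i _ => ?_
        rw [mul_comm]
        exact mul_le_mul_of_nonneg_right (hgap i i.2).le (sq_nonneg _)
      rw [hv, G_add, Submodule.coe_add, Q_add, hB, hΓ, hu.2, G_eq_of_mem_unitEigenvectors hu]
      linarith
    exact div_le_div_of_nonneg_right (sub_le_sub h5 h6) (htpos _).le
  linarith

end LocalAssumptions
end RayleighData

/-! ### Convex hulls of compact sets of functionals -/

/-- By Carathéodory's theorem the convex hull is the image of a compact set of convex
combinations with a fixed number of terms. -/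
theorem IsCompact.convexHull_of_finiteDimensional {E : Type*} [NormedAddCommGroup E]
    [NormedSpace ℝ E] [FiniteDimensional ℝ E] {s : Set E} (hs : IsCompact s) :
    IsCompact (convexHull ℝ s) := by
  rcases s.eq_empty_or_nonempty with rfl | ⟨p, hp⟩
  · simp
  set n := Module.finrank ℝ E + 1 with hn
  have hK : IsCompact (stdSimplex ℝ (Fin n) ×ˢ (Set.univ.pi fun _ : Fin n => s)) :=
    (isCompact_stdSimplex ℝ (Fin n)).prod (isCompact_univ_pi fun _ => hs)
  have hcont : Continuous fun q : (Fin n → ℝ) × (Fin n → E) => ∑ i, q.1 i • q.2 i := by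
    fun_prop
  convert hK.image hcont using 1
  refine Subset.antisymm (fun v hv => ?_) ?_
  · obtain ⟨ι, hι, z, w, hz, hind, hw, hw1, rfl⟩ := eq_pos_convex_span_of_mem_convexHull hv
    have hcard : Fintype.card ι ≤ Fintype.card (Fin n) := by
      rw [Fintype.card_fin, hn]
      exact hind.card_le_finrank_succ.trans (Nat.succ_le_succ (Submodule.finrank_le _))
    obtain ⟨f⟩ := Function.Embedding.nonempty_of_card_le hcard
    have hf := f.injective
    refine ⟨(Function.extend f w 0, Function.extend f z fun _ => p), ⟨⟨fun i => ?_, ?_⟩, ?_⟩, ?_⟩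
    · by_cases hi : ∃ j, f j = i
      · obtain ⟨j, rfl⟩ := hi
        simpa [hf.extend_apply] using (hw j).le
      · simp [Function.extend_apply' _ _ _ hi]
    · rw [← hw1]
      exact (Fintype.sum_of_injective f hf _ _
        (fun i hi => by simp [Function.extend_apply' _ _ _ (by simpa using hi)])
        (fun j => by simp [hf.extend_apply])).symm
    · intro i _
      by_cases hi : ∃ j, f j = i
      · obtain ⟨j, rfl⟩ := hi
        simpa [hf.extend_apply] using hz ⟨j, rfl⟩
      · simpa [Function.extend_apply' _ _ _ hi] using hp
    · exact (Fintype.sum_of_injective f hf _ _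
        (fun i hi => by simp [Function.extend_apply' _ _ _ (by simpa using hi)])
        (fun j => by simp [hf.extend_apply])).symm
  · rintro _ ⟨⟨a, z⟩, ⟨ha, hz⟩, rfl⟩
    exact (convex_convexHull ℝ s).sum_mem (fun i _ => ha.1 i) ha.2
      fun i _ => subset_convexHull ℝ s (hz i (mem_univ i))

theorem IsCompact.convexHull_of_subset_finiteDimensional {E : Type*} [NormedAddCommGroup E]
    [NormedSpace ℝ E] {s : Set E} (hs : IsCompact s) (W : Submodule ℝ E) [FiniteDimensional ℝ W]
    (hsW : s ⊆ W) : IsCompact (convexHull ℝ s) := by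
  have himage : W.subtype '' (W.subtype ⁻¹' s) = s := by
    rw [image_preimage_eq_iff]
    simpa using hsW
  have hpre : IsCompact (W.subtype ⁻¹' s) := by
    rw [Subtype.isCompact_iff]
    exact himage.symm ▸ hs
  have h1 := hpre.convexHull_of_finiteDimensional.image W.subtypeL.continuous
  have h2 : W.subtype '' convexHull ℝ (W.subtype ⁻¹' s) = convexHull ℝ s := by
    rw [LinearMap.image_convexHull, himage]
  exact h2 ▸ h1

/-- A functional outside a compact convex set of functionals is strictly separated from it by
a vector of the space, and not only by an element of its bidual: the set is also compact
for the weak-* topology. -/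
theorem exists_vector_separating {X : Type*} [NormedAddCommGroup X] [NormedSpace ℝ X]
    {C : Set (X →L[ℝ] ℝ)} (hconv : Convex ℝ C) (hC : IsCompact C) {ζ : X →L[ℝ] ℝ} (hζ : ζ ∉ C) :
    ∃ (d : X) (a : ℝ), (∀ ξ ∈ C, ξ d < a) ∧ a < ζ d := by
  have : LocallyConvexSpace ℝ (WeakDual ℝ X) :=
    inferInstanceAs (LocallyConvexSpace ℝ (WeakBilin (topDualPairing ℝ X)))
  have hC' : IsCompact (StrongDual.toWeakDual '' C) :=
    hC.image NormedSpace.Dual.toWeakDual_continuous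
  have hconv' : Convex ℝ (StrongDual.toWeakDual (𝕜 := ℝ) (E := X) '' C) :=
    hconv.linear_image (StrongDual.toWeakDual (𝕜 := ℝ) (E := X)).toLinearMap
  have hζ' : StrongDual.toWeakDual ζ ∉ StrongDual.toWeakDual '' C := by
    rwa [(StrongDual.toWeakDual (𝕜 := ℝ) (E := X)).injective.mem_set_image]
  obtain ⟨f, a, h1, h2⟩ := geometric_hahn_banach_closed_point hconv' hC'.isClosed hζ'
  obtain ⟨d, hd⟩ := LinearMap.dualEmbedding_surjective (topDualPairing ℝ X) f
  have hfd : ∀ ξ : X →L[ℝ] ℝ, f (StrongDual.toWeakDual ξ) = ξ d := fun ξ => by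
    rw [← hd]; rfl
  exact ⟨d, a, fun ξ hξ => hfd ξ ▸ h1 _ ⟨ξ, hξ, rfl⟩, hfd ζ ▸ h2⟩

/-! ### Compactness of the convex hull of the derivatives -/

namespace RayleighData

variable {X Y : Type*} [NormedAddCommGroup X] [NormedSpace ℝ X] [AddCommGroup Y] [Module ℝ Y]
variable {D : RayleighData X Y} {Ω : Set X} {x y : X} {V : Set X} {θ : X → ℝ}

/-- The eigenspace as a linear subspace of `H`. -/
def eigenSubmodule (D : RayleighData X Y) (k : ℕ) (y : X) : Submodule ℝ D.H :=
  LinearMap.ker (D.Γ y - D.eigenvalue k y • D.BH y)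

theorem mem_eigenSubmodule {k : ℕ} {u : D.H} :
    u ∈ D.eigenSubmodule k y ↔ u ∈ D.eigenspace k y := by
  rw [mem_eigenspace_iff, eigenSubmodule, LinearMap.mem_ker, LinearMap.ext_iff]
  simp [sub_eq_zero]

namespace LocalAssumptions

variable (h : D.LocalAssumptions Ω x V θ) (hD : D.StandingAssumptions Ω)
include h hD

theorem exists_unitEigenvectors_subseq {k : ℕ} {u : ℕ → D.H}
    (hu : ∀ n, u n ∈ D.unitEigenvectors k x) :
    ∃ u₀ ∈ D.unitEigenvectors k x, ∃ φ : ℕ → ℕ, StrictMono φ ∧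
      D.TendstoEnergy θ x (fun n => u (φ n)) u₀ := by
  obtain ⟨u₀, φ, hφ, h1, h2, h3⟩ := h.exists_eigenvector_limit hD (xs := fun _ => x)
    (fun _ => h.mem) tendsto_const_nhds (μ := fun _ => D.eigenvalue k x) tendsto_const_nhds
    (fun n => (hu n).2) (fun n => mem_eigenspace_iff.1 (hu n).1)
  exact ⟨u₀, ⟨mem_eigenspace_iff.2 h3, h2⟩, φ, hφ, h1⟩

theorem finiteDimensional_eigenSubmodule (k : ℕ) :
    FiniteDimensional ℝ (D.eigenSubmodule k x) := by
  have hx := h.subset h.mem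
  by_contra hinf
  -- An infinite orthonormal sequence of eigenvectors has no convergent subsequence.
  obtain ⟨f, hf, horth⟩ := exists_seq_of_forall_finset_exists
    (fun u : D.H => u ∈ D.unitEigenvectors k x) (fun u v => D.BH x u v = 0) fun s _ => by
      obtain ⟨u, huE, hu, h1⟩ := (D.eigenSubmodule k x).exists_ne_zero_forall_apply_eq_zero
        (fun i : Fin s.card => D.BH x (s.equivFin.symm i : D.H)) fun hfin => (hinf hfin).elim
      obtain ⟨a, -, ha⟩ := exists_smul_unit (hD.posDef x hx) hu
      refine ⟨a • u, ⟨mem_eigenSubmodule.1 (Submodule.smul_mem _ _ huE), ha⟩, fun v hv => ?_⟩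
      have := h1 (s.equivFin ⟨v, hv⟩)
      rw [Equiv.symm_apply_apply] at this
      rw [map_smul, this, smul_zero]
  obtain ⟨u₀, -, φ, hφ, hlim⟩ := h.exists_unitEigenvectors_subseq hD hf
  have h1 := hlim.comp (tendsto_add_atTop_nat 1)
  have h2 := h.tendstoEnergy_add hlim (h.tendstoEnergy_smul (tendsto_const_nhds (x := (-1 : ℝ))) h1)
  have h3 := (h.tendsto_forms hD (tendsto_const_nhds (x := x)) h2).1.1
  have h4 : ∀ n, D.Q x ((f (φ n) + (-1 : ℝ) • f (φ (n + 1)) : D.H) : Y) = 2 := fun n => by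
    have h5 := horth _ _ (hφ n.lt_succ_self)
    rw [BH_apply] at h5
    rw [Submodule.coe_add, Q_add, Submodule.coe_smul, Q_smul, map_smul, h5, (hf _).2, (hf _).2]
    norm_num
  simp only [h4] at h3
  have h5 := tendsto_nhds_unique h3 tendsto_const_nhds
  simp at h5

theorem isCompact_image_Rx (k : ℕ) : IsCompact (D.Rx x '' D.unitEigenvectors k x) := by
  refine IsSeqCompact.isCompact fun ξ hξ => ?_
  choose u hu hξu using hξ
  obtain ⟨u₀, hu₀, φ, hφ, hlim⟩ := h.exists_unitEigenvectors_subseq hD hu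
  refine ⟨_, ⟨u₀, hu₀, rfl⟩, φ, hφ, ?_⟩
  have h0 : u₀ ≠ 0 := by
    rintro rfl
    simpa using hu₀.2
  have := h.tendsto_Rx hD (tendsto_const_nhds (x := x)) hlim h0
  simpa only [Function.comp_def, ← hξu] using this

omit hD in
theorem differentiableAt_B (u v : Y) : DifferentiableAt ℝ (fun y => D.B y u v) x := by
  simp only [B_eq]
  simp only [div_eq_mul_inv]
  exact (((h.differentiable_Q _).fun_sub (h.differentiable_Q _)).fun_sub
    (h.differentiable_Q _)).mul_const _

omit hD in
theorem differentiableAt_Γ (u v : D.H) : DifferentiableAt ℝ (fun y => D.Γ y u v) x := by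
  simp only [Γ_eq]
  simp only [div_eq_mul_inv]
  exact (((h.differentiable_G _).fun_sub (h.differentiable_G _)).fun_sub
    (h.differentiable_G _)).mul_const _

omit hD in
/-- The derivative in the parameter of `G - a Q` is a quadratic function of the vector. -/
theorem exists_bilinear_fderiv (a : ℝ) : ∃ T : D.H →ₗ[ℝ] D.H →ₗ[ℝ] (X →L[ℝ] ℝ), ∀ u,
    T u u = fderiv ℝ (fun y => D.G y u) x - a • fderiv ℝ (fun y => D.Q y (u : Y)) x := by
  have hd : ∀ u v : D.H, DifferentiableAt ℝ (fun y => D.Γ y u v - a * D.BH y u v) x :=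
    fun u v => (h.differentiableAt_Γ u v).sub ((h.differentiableAt_B u v).const_mul a)
  refine ⟨LinearMap.mk₂ ℝ (fun u v => fderiv ℝ (fun y => D.Γ y u v - a * D.BH y u v) x)
    (fun u u' v => ?_) (fun c u v => ?_) (fun u v v' => ?_) (fun c u v => ?_), fun u => ?_⟩
  · rw [← fderiv_fun_add (hd _ _) (hd _ _)]
    congr 1; ext y
    rw [map_add, map_add, LinearMap.add_apply, LinearMap.add_apply]; ring
  · rw [← fderiv_fun_const_smul (hd _ _)]
    congr 1; ext y
    rw [map_smul, map_smul, LinearMap.smul_apply, LinearMap.smul_apply]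
    simp only [smul_eq_mul]; ring
  · rw [← fderiv_fun_add (hd _ _) (hd _ _)]
    congr 1; ext y
    rw [map_add, map_add]; ring
  · rw [← fderiv_fun_const_smul (hd _ _)]
    congr 1; ext y
    rw [map_smul, map_smul]
    simp only [smul_eq_mul]; ring
  · simp only [LinearMap.mk₂_apply, Γ_self, BH_self]
    rw [fderiv_fun_sub (h.differentiable_G u) ((h.differentiable_Q u).const_mul a),
      fderiv_const_mul (h.differentiable_Q u)]

theorem isCompact_C (k : ℕ) : IsCompact (D.C k x) := by
  have hx := h.subset h.mem
  have hfin := h.finiteDimensional_eigenSubmodule hD k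
  obtain ⟨T, hT⟩ := h.exists_bilinear_fderiv (D.eigenvalue k x)
  -- The derivative is a quadratic function of the unit eigenvector.
  let E := D.eigenSubmodule k x
  let W := LinearMap.range (TensorProduct.lift (T.compl₁₂ E.subtype E.subtype))
  refine (h.isCompact_image_Rx hD k).convexHull_of_subset_finiteDimensional W ?_
  rintro _ ⟨u, hu, rfl⟩
  have h0 : u ≠ 0 := by
    rintro rfl
    simpa using hu.2
  obtain ⟨v, rfl⟩ : ∃ v : E, (v : D.H) = u := ⟨⟨u, mem_eigenSubmodule.2 hu.1⟩, rfl⟩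
  refine ⟨v ⊗ₜ v, ?_⟩
  rw [TensorProduct.lift.tmul, LinearMap.compl₁₂_apply, Submodule.subtype_apply, hT,
    hD.Rx_eq hx h0, R, G_eq_of_mem_unitEigenvectors hu, hu.2, inv_one, one_smul, div_one]

end LocalAssumptions
end RayleighData

/-! ### Generalized gradients -/

namespace Nonsmooth

variable {X : Type*} [NormedAddCommGroup X] [NormedSpace ℝ X] {F : X → ℝ} {x : X}

theorem tendsto_quotient {d : X} {a : ℝ} (ha : HasRightDirDeriv F x d a) :
    Tendsto (fun t : ℝ => quotient F d (x, t)) (𝓝[>] 0) (𝓝 (a : EReal)) :=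
  (continuous_coe_real_ereal.tendsto a).comp ha

theorem tendsto_mk_nhdsGT : Tendsto (fun t : ℝ => (x, t)) (𝓝[>] 0) (𝓝 x ×ˢ 𝓝[>] (0 : ℝ)) :=
  tendsto_const_nhds.prodMk tendsto_id

theorem HasRightDirDeriv.le_upperDirDeriv {d : X} {a : ℝ} (ha : HasRightDirDeriv F x d a) :
    (a : EReal) ≤ upperDirDeriv F x d := by
  rw [← (tendsto_quotient ha).limsup_eq]
  exact limsup_le_limsup_of_le (f := map (fun t : ℝ => (x, t)) (𝓝[>] 0)) (u := quotient F d)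
    tendsto_mk_nhdsGT

theorem HasRightDirDeriv.lowerDirDeriv_le {d : X} {a : ℝ} (ha : HasRightDirDeriv F x d a) :
    lowerDirDeriv F x d ≤ (a : EReal) := by
  rw [← (tendsto_quotient ha).liminf_eq]
  exact liminf_le_liminf_of_le (g := map (fun t : ℝ => (x, t)) (𝓝[>] 0)) (u := quotient F d)
    tendsto_mk_nhdsGT

theorem subdiff_subset_clarkeSubdiff : subdiff F x ⊆ clarkeSubdiff F x := fun ζ hζ d => by
  obtain ⟨a, ha, hle⟩ := hζ d
  exact (EReal.coe_le_coe_iff.2 hle).trans ha.le_upperDirDeriv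

theorem superdiff_subset_clarkeSuperdiff : superdiff F x ⊆ clarkeSuperdiff F x := fun ζ hζ d => by
  obtain ⟨a, ha, hle⟩ := hζ d
  exact ha.lowerDirDeriv_le.trans (EReal.coe_le_coe_iff.2 hle)

end Nonsmooth

namespace RayleighData

open Nonsmooth

variable {X Y : Type*} [NormedAddCommGroup X] [NormedSpace ℝ X] [AddCommGroup Y] [Module ℝ Y]
variable {D : RayleighData X Y} {Ω : Set X} {x y : X} {V : Set X} {θ : X → ℝ}

namespace LocalAssumptions

variable (h : D.LocalAssumptions Ω x V θ) (hD : D.StandingAssumptions Ω)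
  (hH : ¬ FiniteDimensional ℝ D.H)
include h hD hH

theorem clarkeSubdiff_subset_C (m : ℕ) :
    clarkeSubdiff (D.eigenvalue (m + 1)) x ⊆ D.C (m + 1) x := by
  intro ζ hζ
  by_contra hnot
  obtain ⟨d, a, hC, ha⟩ := exists_vector_separating (convex_convexHull ℝ _)
    (h.isCompact_C hD (m + 1)) hnot
  set ε := (ζ d - a) / 2 with hε
  have hle : upperDirDeriv (D.eigenvalue (m + 1)) x d ≤ ((a + ε : ℝ) : EReal) := by
    refine limsup_le_of_le (by isBoundedDefault) ?_
    filter_upwards [h.eventually_quotient_le hD hH m d (ε := ε) (by linarith)] with p hp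
    obtain ⟨u, hu, hp⟩ := hp
    have h1 := hC _ (subset_convexHull ℝ _ ⟨u, hu, rfl⟩)
    exact EReal.coe_le_coe_iff.2 (by linarith)
  have h2 := EReal.coe_le_coe_iff.1 ((hζ d).trans hle)
  linarith

theorem clarkeSuperdiff_subset_C (m : ℕ) :
    clarkeSuperdiff (D.eigenvalue (m + 1)) x ⊆ D.C (m + 1) x := by
  intro ζ hζ
  by_contra hnot
  obtain ⟨d, a, hC, ha⟩ := exists_vector_separating (convex_convexHull ℝ _)
    (h.isCompact_C hD (m + 1)) hnot
  set ε := (ζ d - a) / 2 with hε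
  have hle : ((-(a + ε) : ℝ) : EReal) ≤ lowerDirDeriv (D.eigenvalue (m + 1)) x (-d) := by
    refine le_liminf_of_le (by isBoundedDefault) ?_
    filter_upwards [h.eventually_le_quotient hD hH m (-d) (ε := ε) (by linarith)] with p hp
    obtain ⟨u, hu, hp⟩ := hp
    have h1 := hC _ (subset_convexHull ℝ _ ⟨u, hu, rfl⟩)
    rw [map_neg] at hp
    exact EReal.coe_le_coe_iff.2 (by linarith)
  have h2 := EReal.coe_le_coe_iff.1 (hle.trans (hζ (-d)))
  rw [map_neg] at h2
  linarith

theorem image_Rx_nonempty (m : ℕ) : (D.Rx x '' D.unitEigenvectors (m + 1) x).Nonempty := by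
  obtain ⟨e, he⟩ := hD.exists_eigensystem hH (h.subset h.mem) (m + 1)
  exact ⟨_, e m, ⟨mem_eigenspace_iff.2 (he.eigen m m.lt_succ_self), he.Q_eq m.lt_succ_self⟩, rfl⟩

/-- At a gap above the eigenvalue, the right derivative in direction `d` is the maximum of
`R_x(x, u) d` over the unit eigenvectors `u`. -/
theorem C_subset_subdiff {m : ℕ} (hgap : D.eigenvalue (m + 1) x < D.eigenvalue (m + 2) x) :
    D.C (m + 1) x ⊆ subdiff (D.eigenvalue (m + 1)) x := by
  intro ζ hζ d
  obtain ⟨_, ⟨u, hu, rfl⟩, hmax⟩ := (h.isCompact_image_Rx hD (m + 1)).exists_isMaxOn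
    (h.image_Rx_nonempty hD hH m) (f := fun ξ : X →L[ℝ] ℝ => ξ d) (by fun_prop)
  refine ⟨D.Rx x u d, ?_, ?_⟩
  · refine tendsto_order.2 ⟨fun a ha => ?_, fun a ha => ?_⟩
    · filter_upwards [h.eventually_le_quotient_of_lt hD hH hgap hu d
        (ε := (D.Rx x u d - a) / 2) (by linarith)] with t ht
      linarith
    · filter_upwards [tendsto_mk_nhdsGT.eventually (h.eventually_quotient_le hD hH m d
        (ε := (a - D.Rx x u d) / 2) (by linarith))] with t ht
      obtain ⟨v, hv, hle⟩ := ht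
      have h1 : D.Rx x v d ≤ D.Rx x u d := hmax ⟨v, hv, rfl⟩
      linarith
  · refine convexHull_min (t := {ξ : X →L[ℝ] ℝ | ξ d ≤ D.Rx x u d}) (fun ξ hξ => hmax hξ) ?_ hζ
    exact convex_halfSpace_le (f := fun ξ : X →L[ℝ] ℝ => ξ d) ⟨fun _ _ => rfl, fun _ _ => rfl⟩ _

/-- At a gap below the eigenvalue, the right derivative in direction `d` is the minimum of
`R_x(x, u) d` over the unit eigenvectors `u`. -/
theorem C_subset_superdiff {m : ℕ}
    (hgap : ∀ i < m, D.eigenvalue (i + 1) x < D.eigenvalue (m + 1) x) :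
    D.C (m + 1) x ⊆ superdiff (D.eigenvalue (m + 1)) x := by
  intro ζ hζ d
  obtain ⟨_, ⟨u, hu, rfl⟩, hmin⟩ := (h.isCompact_image_Rx hD (m + 1)).exists_isMinOn
    (h.image_Rx_nonempty hD hH m) (f := fun ξ : X →L[ℝ] ℝ => ξ d) (by fun_prop)
  refine ⟨D.Rx x u d, ?_, ?_⟩
  · refine tendsto_order.2 ⟨fun a ha => ?_, fun a ha => ?_⟩
    · filter_upwards [tendsto_mk_nhdsGT.eventually (h.eventually_le_quotient hD hH m d
        (ε := (D.Rx x u d - a) / 2) (by linarith))] with t ht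
      obtain ⟨v, hv, hle⟩ := ht
      have h1 : D.Rx x u d ≤ D.Rx x v d := hmin ⟨v, hv, rfl⟩
      linarith
    · filter_upwards [h.eventually_quotient_le_of_lt hD hH hgap hu d
        (ε := (a - D.Rx x u d) / 2) (by linarith)] with t ht
      linarith
  · refine convexHull_min (t := {ξ : X →L[ℝ] ℝ | D.Rx x u d ≤ ξ d}) (fun ξ hξ => hmin hξ) ?_ hζ
    exact convex_halfSpace_ge (f := fun ξ : X →L[ℝ] ℝ => ξ d) ⟨fun _ _ => rfl, fun _ _ => rfl⟩ _

end LocalAssumptions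
end RayleighData

end

theorem proposition3p9 {X Y : Type*} [NormedAddCommGroup X] [NormedSpace ℝ X] [CompleteSpace X]
    [AddCommGroup Y] [Module ℝ Y] (D : RayleighData X Y) (Ω : Set X) (hΩ : IsOpen Ω)
    (hD : D.StandingAssumptions Ω) (hH : ¬ FiniteDimensional ℝ D.H)
    (x : X) (hx : x ∈ Ω) (k : ℕ) (hk : 1 ≤ k) :
    Nonsmooth.clarkeSubdiff (D.eigenvalue k) x ⊆ D.C k x ∧
    Nonsmooth.clarkeSuperdiff (D.eigenvalue k) x ⊆ D.C k x ∧
    (D.eigenvalue k x < D.eigenvalue (k + 1) x →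
      Nonsmooth.subdiff (D.eigenvalue k) x = D.C k x ∧
      Nonsmooth.clarkeSubdiff (D.eigenvalue k) x = D.C k x) ∧
    (k = 1 ∨ D.eigenvalue (k - 1) x < D.eigenvalue k x →
      Nonsmooth.superdiff (D.eigenvalue k) x = D.C k x ∧
      Nonsmooth.clarkeSuperdiff (D.eigenvalue k) x = D.C k x) := by
  obtain ⟨m, rfl⟩ : ∃ m, k = m + 1 := ⟨k - 1, by omega⟩
  obtain ⟨V, θ, h⟩ := hD.loc x hx
  have hsub := h.clarkeSubdiff_subset_C hD hH m
  have hsuper := h.clarkeSuperdiff_subset_C hD hH m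
  refine ⟨hsub, hsuper, fun hgap => ?_, fun hgap => ?_⟩
  · have hC := h.C_subset_subdiff hD hH hgap
    have hcl := Nonsmooth.subdiff_subset_clarkeSubdiff (F := D.eigenvalue (m + 1)) (x := x)
    exact ⟨(hcl.trans hsub).antisymm hC, hsub.antisymm (hC.trans hcl)⟩
  · have hlt : ∀ i < m, D.eigenvalue (i + 1) x < D.eigenvalue (m + 1) x := fun i hi => by
      obtain ⟨e, he⟩ := hD.exists_eigensystem hH hx m
      rcases hgap with h1 | h1
      · omega
      · obtain ⟨l, rfl⟩ : ∃ l, m = l + 1 := ⟨m - 1, by omega⟩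
        exact (he.eigenvalue_mono hD hx (Nat.lt_succ_iff.1 hi) l.lt_succ_self).trans_lt h1
    have hC := h.C_subset_superdiff hD hH hlt
    have hcl := Nonsmooth.superdiff_subset_clarkeSuperdiff (F := D.eigenvalue (m + 1)) (x := x)
    exact ⟨(hcl.trans hsuper).antisymm hC, hsuper.antisymm (hC.trans hcl)⟩
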